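/- Let $L>0$ and $c>0$ and put $$f_0=\frac{-519801-761\sqrt{467857}}{303170688}=-0.00343\ldots .$$ For a real feedback parameter $f$, a delay function $\delta$, and an initial state $(y_0,y_1)\in H^1(0,L)\times L^2(0,L)$ with $y_0(0)=0$, consider the system ${\bf S_1}$ with $\iota=2$: $$v(0,x)=y_0(x),\quad v_t(0,x)=y_1(x),\quad x\in(0,L),$$ $$v_{tt}(t,x)=c^2v_{xx}(t,x),\quad (t,x)\in\Omega=(0,\infty)\times(0,L),$$ $$v(t,0)=0,\quad t>0,\qquad v_x(t,L)=0,\quad t\in(0,8L/c),$$ $$v_x(t,L)=\frac{f}{c}\,v_t\bigl(t-\delta(t),L\bigr),\quad t>8L/c .$$ A solution is a continuous function $v$ on $[0,\infty)\times[0,L]$ that has weak derivatives $v_t,v_x\in L^1_{\rm loc}(\Omega)$, satisfies the wave equation in the weak sense $\int_\Omega v_t\varphi_t\,d(t,x)=c^2\int_\Omega v_x\varphi_x\,d(t,x)$ for all compactly supported $\varphi\in C^2(\Omega)$, and satisfies the initial and boundary conditions, those on derivatives of $v$ holding almost everywhere (with one-sided derivatives in $t$ at $t=0$ and in $x$ at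 $x=L$). Let $$E(t)=\frac12\int_0^L\bigl(\partial_xv(t,x)\bigr)^2+\frac1{c^2}\bigl(\partial_tv(t,x)\bigr)^2\,dx,\qquad E_1(t)=\sum_{j=0}^4E\Bigl(t+2j\frac Lc\Bigr).$$ Then there is a neighbourhood $U$ of $f_0$ such that for every $f\in U$ there are constants $C_0>0$, $q\in(0,1)$, $C_1>0$, $\mu>0$ with the following property. For every piecewise constant delay $\delta$ with $\delta(t)\in\{4L/c,\,8L/c\}$ for all $t\ge0$ (switching arbitrarily), every initial state $(y_0,y_1)$ as above, and every solution $v$ of ${\bf S_1}$, the energy $E(t)$ is finite for every $t\ge 0$, the energy decays exponentially, $$E(t)\le C_1\,E(0)\,e^{-\mu t}\qquad\text{for all }t\ge0,$$ and $$E_1\Bigl(t+2j\frac Lc\Bigr)\le q^j\,C_0\,E_1(0)\qquad\text{for all }j\in\{0,1,2,\ldots\}\text{ and all }t\in[0,2L/c).$$ -/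

import Mathlib

open Set Filter Topology MeasureTheory

namespace DelayedWave

noncomputable section

/-- The explicit algebraic number `f₀ = -0.00343…`. -/
def f₀ : ℝ := (-519801 - 761 * Real.sqrt 467857) / 303170688

/-- `δ` is piecewise constant on `[0, ∞)`: there are breakpoints
`0 = τ 0 < τ 1 < …` tending to infinity such that `δ` is constant on each open interval
between consecutive breakpoints. -/
def PiecewiseConstant (δ : ℝ → ℝ) : Prop :=
  ∃ τ : ℕ → ℝ, τ 0 = 0 ∧ StrictMono τ ∧ Tendsto τ atTop atTop ∧
    ∀ n : ℕ, ∀ s ∈ Ioo (τ n) (τ (n + 1)), ∀ t ∈ Ioo (τ n) (τ (n + 1)), δ s = δ t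

/-- The set of initial states: `y₀ ∈ H¹(0, L)` (the absolutely continuous representative, with
square-integrable derivative), `y₀ 0 = 0` and `y₁ ∈ L²(0, L)`. -/
structure InitialState (L : ℝ) (y₀ y₁ : ℝ → ℝ) : Prop where
  absolutelyContinuous : AbsolutelyContinuousOnInterval y₀ 0 L
  memLp_deriv : MemLp (deriv y₀) 2 (volume.restrict (Ioo 0 L))
  zero : y₀ 0 = 0
  memLp_velocity : MemLp y₁ 2 (volume.restrict (Ioo 0 L))

/-- The space-time domain `Ω = (0, ∞) × (0, L)`, with points `(t, x)`. -/
def domain (L : ℝ) : Set (ℝ × ℝ) := Ioi 0 ×ˢ Ioo 0 L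

/-- Test functions: `C²`, with compact support contained in `Ω`. -/
structure IsTest (L : ℝ) (φ : ℝ → ℝ → ℝ) : Prop where
  contDiff : ContDiff ℝ 2 (fun p : ℝ × ℝ => φ p.1 p.2)
  hasCompactSupport : HasCompactSupport (fun p : ℝ × ℝ => φ p.1 p.2)
  tsupport_subset : tsupport (fun p : ℝ × ℝ => φ p.1 p.2) ⊆ domain L

/-- The partial derivative of `φ` with respect to the first variable (time). -/
def dt (φ : ℝ → ℝ → ℝ) (p : ℝ × ℝ) : ℝ := deriv (fun t => φ t p.2) p.1

/-- The partial derivative of `φ` with respect to the second variable (space). -/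
def dx (φ : ℝ → ℝ → ℝ) (p : ℝ × ℝ) : ℝ := deriv (fun x => φ p.1 x) p.2

/-- `v_tt = c² v_xx` on `Ω` in the weak sense: `v` has weak first partial derivatives
`v_t, v_x ∈ L¹_loc(Ω)`, and `∫ v_t φ_t = c² ∫ v_x φ_x` for all test functions `φ`. -/
def IsWeakWave (L c : ℝ) (v : ℝ → ℝ → ℝ) : Prop :=
  ∃ vt vx : ℝ × ℝ → ℝ,
    LocallyIntegrableOn vt (domain L) ∧ LocallyIntegrableOn vx (domain L) ∧
    (∀ φ, IsTest L φ →
      ∫ p in domain L, v p.1 p.2 * dt φ p = -∫ p in domain L, vt p * φ p.1 p.2) ∧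
    (∀ φ, IsTest L φ →
      ∫ p in domain L, v p.1 p.2 * dx φ p = -∫ p in domain L, vx p * φ p.1 p.2) ∧
    (∀ φ, IsTest L φ →
      ∫ p in domain L, vt p * dt φ p = c ^ 2 * ∫ p in domain L, vx p * dx φ p)

/-- `v` (on `[0, ∞) × [0, L]`) solves the string system with string length `L`, wave speed `c`,
feedback parameter `f`, delay `δ`, delay bound `4 ι L / c` and initial state `(y₀, y₁)`.
The displacement is continuous; the conditions on derivatives at `t = 0` and at `x = L`
hold almost everywhere, the derivatives there being one-sided (in `t`, respectively in `x`). -/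
structure IsSolution (L c f : ℝ) (ι : ℕ) (δ y₀ y₁ : ℝ → ℝ) (v : ℝ → ℝ → ℝ) : Prop where
  continuousOn : ContinuousOn (fun p : ℝ × ℝ => v p.1 p.2) (Ici 0 ×ˢ Icc 0 L)
  initial_position : ∀ x ∈ Icc 0 L, v 0 x = y₀ x
  initial_velocity : ∀ᵐ x ∂(volume.restrict (Ioo 0 L)),
    HasDerivWithinAt (fun t => v t x) (y₁ x) (Ici 0) 0
  wave : IsWeakWave L c v
  left_end : ∀ t > 0, v t 0 = 0
  right_end_free : ∀ᵐ t ∂(volume.restrict (Ioo 0 (4 * ι * (L / c)))),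
    HasDerivWithinAt (fun x => v t x) 0 (Iic L) L
  right_end_feedback : ∀ᵐ t ∂(volume.restrict (Ioi (4 * ι * (L / c)))),
    ∃ w : ℝ, HasDerivAt (fun s => v s L) w (t - δ t) ∧
      HasDerivWithinAt (fun x => v t x) (f / c * w) (Iic L) L

/-- The energy density `v_x² + v_t² / c²` (the time derivative at `t = 0` is one-sided). -/
def energyDensity (c : ℝ) (v : ℝ → ℝ → ℝ) (t x : ℝ) : ℝ :=
  (deriv (fun ξ => v t ξ) x) ^ 2 +
    1 / c ^ 2 * (derivWithin (fun s => v s x) (Ici 0) t) ^ 2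

/-- The energy `E(t) = ½ ∫₀ᴸ (v_x² + v_t² / c²) dx`. -/
def energy (L c : ℝ) (v : ℝ → ℝ → ℝ) (t : ℝ) : ℝ :=
  1 / 2 * ∫ x in Ioo 0 L, energyDensity c v t x

/-- `E₁(t) = ∑_{j=0}^{4} E(t + 2 j L / c)`. -/
def energy₁ (L c : ℝ) (v : ℝ → ℝ → ℝ) (t : ℝ) : ℝ :=
  ∑ j ∈ Finset.range 5, energy L c v (t + 2 * j * (L / c))

end

end DelayedWave

/-! A weak solution vanishing at the left end is `F (c t + x) - F (c t - x)` with `F` differentiable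
almost everywhere (d'Alembert, `IsWeakWave.exists_profile`). With `g = F'`, the energy at time `t`
is the integral of `g²` over `[c t - L, c t + L]`, and the condition at `x = L` becomes a recursion
along translates by `2 L`.

For almost every `r` in `(-L, L)` put `a n = (-1)^n g (r + 2 n L)` and `h = -f`. The free phase
makes the first five terms equal. Afterwards `a (n + 5)` is `a (n + 4)` minus `h` times a sum of two
earlier consecutive terms, the delay deciding at each step which two. Replacing both earlier terms
by `a (n + 4)` would give the factor `1 - 2 h`. The error is `h` times a sum of at most seven
increments, each itself `O(h)`, so it is `O(h²)` and costs at most another `h`: every switching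
pattern contracts by `1 - h` per step, once `0 < h ≤ 1/22` (`abs_le_of_delayed_recursion`). This
pointwise bound is squared and integrated over a window, giving `q = (1 + f)²`.

The neighbourhood is `(-1/22, 0)`; the only fact used about `f₀` is that it lies there.

The analytic work is d'Alembert's formula for weak solutions. In characteristic coordinates the
equation says that the mixed derivative vanishes weakly, which for a continuous function is the
parallelogram identity. Reflecting characteristics at the two ends of the string then builds `F`,
and the weak first derivatives make it differentiable almost everywhere. -/

namespace DelayedWave

/-! ### Bumps and weak derivatives in one variable -/

/-- Smooth functions with compact support in the interval `(α, β)`. -/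
structure IsBump (α β : ℝ) (a : ℝ → ℝ) : Prop where
  contDiff : ContDiff ℝ (⊤ : ℕ∞) a
  compact : HasCompactSupport a
  supp : tsupport a ⊆ Ioo α β

theorem exists_isBump {α β : ℝ} (h : α < β) :
    ∃ a, IsBump α β a ∧ ∫ x, a x = 1 := by
  let φ : ContDiffBump ((α + β) / 2) := ⟨(β - α) / 8, (β - α) / 4, by linarith, by linarith⟩
  refine ⟨φ.normed volume, ⟨φ.contDiff_normed, φ.hasCompactSupport_normed, ?_⟩,
    φ.integral_normed⟩
  rw [φ.tsupport_normed_eq, Real.closedBall_eq_Icc]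
  intro x hx
  simp only [φ, mem_Icc, mem_Ioo] at hx ⊢
  constructor <;> linarith [hx.1, hx.2]

theorem IsBump.deriv {α β : ℝ} {a : ℝ → ℝ} (ha : IsBump α β a) : IsBump α β (deriv a) :=
  ⟨(contDiff_infty_iff_deriv.1 ha.contDiff).2, ha.compact.deriv,
    (tsupport_deriv_subset (𝕜 := ℝ)).trans ha.supp⟩

theorem IsBump.continuous {α β : ℝ} {a : ℝ → ℝ} (ha : IsBump α β a) : Continuous a :=
  ha.contDiff.continuous

theorem IsBump.eq_zero {α β : ℝ} {a : ℝ → ℝ} (ha : IsBump α β a) {x : ℝ} (hx : x ∉ Ioo α β) :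
    a x = 0 :=
  image_eq_zero_of_notMem_tsupport fun h => hx (ha.supp h)

/-- The compact support leaves room at both ends of the open interval. This room keeps the support
of a primitive inside the interval. -/
theorem IsBump.exists_Icc {α β : ℝ} (h : α < β) {a : ℝ → ℝ} (ha : IsBump α β a) :
    ∃ α' β', α < α' ∧ α' < β' ∧ β' < β ∧ ∀ x, x ∉ Icc α' β' → a x = 0 := by
  by_cases hne : (tsupport a).Nonempty
  · have hc : IsCompact (tsupport a) := ha.compact
    obtain ⟨m, hm, hm'⟩ := hc.exists_isLeast hne
    obtain ⟨M, hM, hM'⟩ := hc.exists_isGreatest hne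
    have h1 := ha.supp hm
    have h2 := ha.supp hM
    have h3 := hm' hM
    refine ⟨(α + m) / 2, (β + M) / 2, ?_, ?_, ?_, fun x hx => ?_⟩
    · linarith [h1.1]
    · linarith [h1.1, h2.2]
    · linarith [h2.2]
    · refine image_eq_zero_of_notMem_tsupport fun hxs => hx ⟨?_, ?_⟩
      · linarith [hm' hxs, h1.1]
      · linarith [hM' hxs, h2.2]
  · refine ⟨(3 * α + β) / 4, (α + 3 * β) / 4, by linarith, by linarith, by linarith,
      fun x _ => image_eq_zero_of_notMem_tsupport fun hxs => hne ⟨x, hxs⟩⟩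

/-- The antiderivative of a bump of mean zero is a bump. -/
theorem IsBump.exists_primitive {α β : ℝ} (h : α < β) {b : ℝ → ℝ} (hb : IsBump α β b)
    (h0 : ∫ x, b x = 0) : ∃ a, IsBump α β a ∧ _root_.deriv a = b := by
  obtain ⟨α', β', h1, h2, h3, h4⟩ := hb.exists_Icc h
  have hd : ∀ x, HasDerivAt (fun x => ∫ s in α..x, b s) (b x) x := fun x =>
    intervalIntegral.integral_hasDerivAt_right (hb.continuous.intervalIntegrable _ _)
      hb.continuous.stronglyMeasurable.stronglyMeasurableAtFilter hb.continuous.continuousAt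
  have hd' : _root_.deriv (fun x => ∫ s in α..x, b s) = b := funext fun x => (hd x).deriv
  have hz : ∀ x, x ∉ Icc α' β' → ∫ s in α..x, b s = 0 := by
    intro x hx
    by_cases hx1 : x < α'
    · rw [intervalIntegral.integral_zero_ae]
      refine Eventually.of_forall fun y hy => h4 y fun hy' => ?_
      have : y ≤ max α x := hy.2
      have : max α x < α' := max_lt h1 hx1
      linarith [hy'.1]
    · have hx2 : β' < x := by
        by_contra hcon
        exact hx ⟨not_lt.1 hx1, not_lt.1 hcon⟩
      rw [← h0, intervalIntegral.integral_of_le (by linarith)]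
      refine setIntegral_eq_integral_of_forall_compl_eq_zero fun y hy => h4 y fun hy' => hy ?_
      exact ⟨by linarith [hy'.1], by linarith [hy'.2]⟩
  have hsub : tsupport (fun x => ∫ s in α..x, b s) ⊆ Icc α' β' :=
    closure_minimal (fun x hx => by
      by_contra hcon
      exact hx (hz x hcon)) isClosed_Icc
  refine ⟨fun x => ∫ s in α..x, b s, ⟨?_, ?_, ?_⟩, hd'⟩
  · rw [contDiff_infty_iff_deriv, hd']
    exact ⟨fun x => (hd x).differentiableAt, hb.contDiff⟩
  · exact IsCompact.of_isClosed_subset isCompact_Icc (isClosed_tsupport _) hsub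
  · exact hsub.trans fun x hx => ⟨by linarith [hx.1], by linarith [hx.2]⟩

theorem IsBump.integrable_mul {α β : ℝ} {a K : ℝ → ℝ} (ha : IsBump α β a) (hK : Continuous K) :
    Integrable fun x => K x * a x :=
  (hK.mul ha.continuous).integrable_of_hasCompactSupport ha.compact.mul_left

/-- A continuous function with vanishing weak derivative is constant. -/
theorem eq_of_weak_deriv_eq_zero {α β : ℝ} {K : ℝ → ℝ} (hK : Continuous K)
    (h : ∀ a, IsBump α β a → ∫ x, K x * deriv a x = 0) {x y : ℝ}
    (hx : x ∈ Ioo α β) (hy : y ∈ Ioo α β) : K x = K y := by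
  have hαβ : α < β := hx.1.trans hx.2
  obtain ⟨ψ, hψ, hψ1⟩ := exists_isBump hαβ
  set m := ∫ x, K x * ψ x with hm
  have key : ∀ᵐ x, x ∈ Ioo α β → K x - m = 0 := by
    refine isOpen_Ioo.ae_eq_zero_of_integral_contDiff_smul_eq_zero
      ((hK.sub continuous_const).locallyIntegrable.locallyIntegrableOn _) fun g hg1 hg2 hg3 => ?_
    have hg : IsBump α β g := ⟨hg1, hg2, hg3⟩
    -- Subtracting a multiple of the unit bump `ψ` makes the mean zero, so the result is the
    -- derivative of a bump and the hypothesis applies to it. This shows that `K - m` annihilates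
    -- every `g`.
    have hb : IsBump α β (fun x => g x - (∫ y, g y) * ψ x) := by
      refine ⟨hg.contDiff.sub (contDiff_const.mul hψ.contDiff), ?_, ?_⟩
      · exact hg.compact.sub hψ.compact.mul_left
      · refine (tsupport_sub g (fun x => (∫ y, g y) * ψ x)).trans
          (union_subset hg.supp ((tsupport_mul_subset_right).trans hψ.supp))
    have ig : Integrable g := hg.continuous.integrable_of_hasCompactSupport hg.compact
    have iψ : Integrable ψ := hψ.continuous.integrable_of_hasCompactSupport hψ.compact
    obtain ⟨a, ha, ha'⟩ := hb.exists_primitive hαβ (by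
      rw [integral_sub ig (iψ.const_mul _), integral_const_mul, hψ1, mul_one, sub_self])
    have h1 := h a ha
    rw [ha'] at h1
    have h2 : (fun x => K x * (g x - (∫ y, g y) * ψ x)) =
        fun x => K x * g x - (∫ y, g y) * (K x * ψ x) := by
      funext x; ring
    rw [h2, integral_sub (hg.integrable_mul hK) ((hψ.integrable_mul hK).const_mul _),
      integral_const_mul, ← hm] at h1
    have h3 : (fun x => g x • (K x - m)) = fun x => K x * g x - m * g x := by
      funext x; simp only [smul_eq_mul]; ring
    rw [h3, integral_sub (hg.integrable_mul hK) (ig.const_mul _), integral_const_mul]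
    linarith
  have key2 : EqOn (fun x => K x - m) (fun _ => 0) (Ioo α β) :=
    Measure.eqOn_open_of_ae_eq (μ := volume) ((ae_restrict_iff' measurableSet_Ioo).2 key) isOpen_Ioo
      (hK.sub continuous_const).continuousOn continuousOn_const
  have e1 := key2 hx
  have e2 := key2 hy
  simp only at e1 e2
  linarith

/-- A continuous function with integrable weak derivative is a primitive of it. -/
theorem sub_eq_integral_of_weak_deriv {α β : ℝ} {K W : ℝ → ℝ} (hK : Continuous K)
    (hW : Integrable W)
    (h : ∀ a, IsBump α β a → ∫ x, K x * deriv a x = -∫ x, W x * a x) {x y : ℝ}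
    (hx : x ∈ Ioo α β) (hy : y ∈ Ioo α β) : K y - K x = ∫ s in x..y, W s := by
  have hαβ : α < β := hx.1.trans hx.2
  have hI : ∀ a b, IntervalIntegrable W volume a b := fun a b => hW.intervalIntegrable
  set A : ℝ → ℝ := fun x => ∫ s in α..x, W s with hA
  have hAc : Continuous A := intervalIntegral.continuous_primitive hI α
  have hAac : AbsolutelyContinuousOnInterval A α β :=
    (hI α β).absolutelyContinuousOnInterval_intervalIntegral (by simp)
  -- `K` and the primitive `A` of `W` have the same weak derivative, the one of `A` coming from
  -- integration by parts; so their difference is constant.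
  have main : K x - A x = K y - A y := by
    refine eq_of_weak_deriv_eq_zero (α := α) (β := β) (K := fun x => K x - A x) (hK.sub hAc)
      (fun a ha => ?_) hx hy
    have h1 : ∫ x, A x * deriv a x = -∫ x, W x * a x := by
      have e1 : ∫ x, A x * deriv a x = ∫ x in α..β, A x * deriv a x := by
        rw [intervalIntegral.integral_of_le hαβ.le]
        refine (setIntegral_eq_integral_of_forall_compl_eq_zero fun y hy => ?_).symm
        rw [ha.deriv.eq_zero fun hy' => hy ⟨hy'.1, hy'.2.le⟩, mul_zero]
      have e2 : ∫ x, W x * a x = ∫ x in α..β, W x * a x := by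
        rw [intervalIntegral.integral_of_le hαβ.le]
        refine (setIntegral_eq_integral_of_forall_compl_eq_zero fun y hy => ?_).symm
        rw [ha.eq_zero fun hy' => hy ⟨hy'.1, hy'.2.le⟩, mul_zero]
      have haac : AbsolutelyContinuousOnInterval a α β :=
        (ha.contDiff.of_le (by exact_mod_cast le_top)).contDiffOn.absolutelyContinuousOnInterval
      rw [e1, e2, hAac.integral_mul_deriv_eq_deriv_mul haac, ha.eq_zero (x := β) (by simp),
        ha.eq_zero (x := α) (by simp), mul_zero, mul_zero, sub_zero, zero_sub]
      congr 1
      refine intervalIntegral.integral_congr_ae ?_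
      filter_upwards [(hI α β).ae_hasDerivAt_integral] with z hz hz'
      rw [(hz (uIoc_subset_uIcc hz') α (by simp)).deriv]
    simp only [sub_mul]
    rw [integral_sub (ha.deriv.integrable_mul hK) (ha.deriv.integrable_mul hAc), h a ha, h1,
      sub_self]
  have : A y - A x = ∫ s in x..y, W s := intervalIntegral.integral_interval_sub_left (hI _ _) (hI _ _)
  linarith

/-! ### Product test functions and the parallelogram identity on a rectangle -/

theorem IsBump.continuous_integral_mul {γ δ : ℝ} {b : ℝ → ℝ} (hb : IsBump γ δ b)
    {V : ℝ × ℝ → ℝ} (hV : Continuous V) : Continuous fun ξ => ∫ η, V (ξ, η) * b η := by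
  have hc := continuous_parametric_integral_of_continuous (μ := volume)
    (f := fun ξ η => V (ξ, η) * b η) (by have := hb.continuous; fun_prop) (s := tsupport b) hb.compact
  refine hc.congr fun ξ => ?_
  refine setIntegral_eq_integral_of_forall_compl_eq_zero fun η hη => ?_
  rw [image_eq_zero_of_notMem_tsupport hη, mul_zero]

theorem IsBump.integrable_prod {α β γ δ : ℝ} {a b : ℝ → ℝ} (ha : IsBump α β a)
    (hb : IsBump γ δ b) {V : ℝ × ℝ → ℝ} (hV : Continuous V) :
    Integrable fun q : ℝ × ℝ => V q * (a q.1 * b q.2) := by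
  refine Continuous.integrable_of_hasCompactSupport ?_ ?_
  · have := ha.continuous
    have := hb.continuous
    fun_prop
  · refine HasCompactSupport.intro (ha.compact.prod hb.compact) fun q hq => ?_
    have : q.1 ∉ tsupport a ∨ q.2 ∉ tsupport b := by
      by_contra hcon
      push Not at hcon
      exact hq ⟨hcon.1, hcon.2⟩
    rcases this with h | h <;> simp [image_eq_zero_of_notMem_tsupport h]

theorem IsBump.integral_integral_mul {α β γ δ : ℝ} {a b : ℝ → ℝ} (ha : IsBump α β a)
    (hb : IsBump γ δ b) {V : ℝ × ℝ → ℝ} (hV : Continuous V) :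
    ∫ ξ, (∫ η, V (ξ, η) * b η) * a ξ = ∫ q : ℝ × ℝ, V q * (a q.1 * b q.2) := by
  rw [Measure.volume_eq_prod, integral_prod _ (ha.integrable_prod hb hV)]
  refine integral_congr_ae (Eventually.of_forall fun ξ => ?_)
  simp only
  rw [← integral_mul_const]
  refine integral_congr_ae (Eventually.of_forall fun η => ?_)
  simp only
  ring

theorem IsBump.integral_integral_mul_swap {α β γ δ : ℝ} {a b : ℝ → ℝ} (ha : IsBump α β a)
    (hb : IsBump γ δ b) {V : ℝ × ℝ → ℝ} (hV : Continuous V) :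
    ∫ η, (∫ ξ, V (ξ, η) * a ξ) * b η = ∫ q : ℝ × ℝ, V q * (a q.1 * b q.2) := by
  rw [Measure.volume_eq_prod, integral_prod_symm _ (ha.integrable_prod hb hV)]
  refine integral_congr_ae (Eventually.of_forall fun ξ => ?_)
  simp only
  rw [← integral_mul_const]
  refine integral_congr_ae (Eventually.of_forall fun η => ?_)
  simp only
  ring

theorem IsBump.exists_bound {α β : ℝ} {a : ℝ → ℝ} (ha : IsBump α β a) : ∃ C, ∀ x, ‖a x‖ ≤ C :=
  ha.compact.exists_bound_of_continuous ha.continuous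

/-- If `∂_ξ ∂_η V = 0` weakly on a rectangle, then `V` satisfies the parallelogram identity. -/
theorem parallelogram_of_weak {α β γ δ : ℝ} {V : ℝ × ℝ → ℝ} (hV : Continuous V)
    (h : ∀ a b, IsBump α β a → IsBump γ δ b →
      ∫ q : ℝ × ℝ, V q * (deriv a q.1 * deriv b q.2) = 0)
    {ξ₁ ξ₂ η₁ η₂ : ℝ} (hξ₁ : ξ₁ ∈ Ioo α β) (hξ₂ : ξ₂ ∈ Ioo α β) (hη₁ : η₁ ∈ Ioo γ δ)
    (hη₂ : η₂ ∈ Ioo γ δ) : V (ξ₁, η₁) + V (ξ₂, η₂) = V (ξ₁, η₂) + V (ξ₂, η₁) := by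
  have hc : ∀ ξ, Continuous fun η => V (ξ, η) := fun ξ => by fun_prop
  -- The one-variable lemma is used twice: integrated against `b'`, `V` does not depend on `ξ`;
  -- hence `V (ξ₁, ·) - V (ξ₂, ·)` has zero weak derivative in `η`.
  have key := eq_of_weak_deriv_eq_zero (α := γ) (β := δ)
    (K := fun η => V (ξ₁, η) - V (ξ₂, η)) ((hc _).sub (hc _)) (fun b hb => ?_) hη₁ hη₂
  · linarith
  · have e := eq_of_weak_deriv_eq_zero (α := α) (β := β)
      (hb.deriv.continuous_integral_mul hV)
      (fun a ha => by rw [ha.deriv.integral_integral_mul hb.deriv hV, h a b ha hb]) hξ₁ hξ₂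
    simp only [sub_mul]
    rw [integral_sub (hb.deriv.integrable_mul (hc _)) (hb.deriv.integrable_mul (hc _)), e, sub_self]

/-- Under the parallelogram identity, a weak derivative of `V` in the second variable makes `V`
differentiable almost everywhere in this variable. -/
theorem ae_differentiableAt_of_weak {α β γ δ : ℝ} {V w : ℝ × ℝ → ℝ} (hV : Continuous V)
    (hw : Integrable w)
    (hP : ∀ ξ₁ ∈ Ioo α β, ∀ ξ₂ ∈ Ioo α β, ∀ η₁ ∈ Ioo γ δ, ∀ η₂ ∈ Ioo γ δ,
      V (ξ₁, η₁) + V (ξ₂, η₂) = V (ξ₁, η₂) + V (ξ₂, η₁))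
    (h : ∀ a b, IsBump α β a → IsBump γ δ b →
      ∫ q : ℝ × ℝ, V q * (a q.1 * deriv b q.2) = -∫ q : ℝ × ℝ, w q * (a q.1 * b q.2))
    {ξ : ℝ} (hξ : ξ ∈ Ioo α β) :
    ∀ᵐ η, η ∈ Ioo γ δ → DifferentiableAt ℝ (fun η => V (ξ, η)) η := by
  rcases le_or_gt δ γ with hγδ | hγδ
  · simp [Ioo_eq_empty_of_le hγδ]
  -- Averaging over `ξ` against a unit bump reduces to one variable. By the parallelogram identity,
  -- increments in `η` do not depend on `ξ`, so averaging leaves them unchanged.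
  obtain ⟨a, ha, ha1⟩ := exists_isBump (hξ.1.trans hξ.2)
  obtain ⟨C, hC⟩ := ha.exists_bound
  have ia : Integrable a := ha.continuous.integrable_of_hasCompactSupport ha.compact
  have hwa : Integrable fun q : ℝ × ℝ => w q * a q.1 :=
    hw.mul_bdd (c := C)
      (ha.continuous.comp continuous_fst).aestronglyMeasurable (Eventually.of_forall fun q => hC q.1)
  have hVs : Continuous fun q : ℝ × ℝ => V (q.2, q.1) := by fun_prop
  have hKc : Continuous fun η => ∫ ξ', V (ξ', η) * a ξ' := ha.continuous_integral_mul hVs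
  have hWi : Integrable fun η => ∫ ξ', w (ξ', η) * a ξ' := hwa.integral_prod_right
  have hK : ∀ x ∈ Ioo γ δ, ∀ y ∈ Ioo γ δ,
      (∫ ξ', V (ξ', y) * a ξ') - (∫ ξ', V (ξ', x) * a ξ') =
        ∫ η in x..y, ∫ ξ', w (ξ', η) * a ξ' := by
    intro x hx y hy
    refine sub_eq_integral_of_weak_deriv (α := γ) (β := δ)
      (K := fun η => ∫ ξ', V (ξ', η) * a ξ') hKc hWi (fun b hb => ?_) hx hy
    rw [ha.integral_integral_mul_swap hb.deriv hV, h a b ha hb]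
    obtain ⟨D, hD⟩ := hb.exists_bound
    have hwab : Integrable fun q : ℝ × ℝ => w q * a q.1 * b q.2 :=
      hwa.mul_bdd (c := D)
        (hb.continuous.comp continuous_snd).aestronglyMeasurable (Eventually.of_forall fun q => hD q.2)
    simp only [← mul_assoc]
    rw [Measure.volume_eq_prod, integral_prod_symm _ hwab]
    simp only [integral_mul_const]
  set x₀ := (γ + δ) / 2 with hx₀
  have hx₀m : x₀ ∈ Ioo γ δ := ⟨by linarith, by linarith⟩
  have hEq : ∀ y ∈ Ioo γ δ,
      V (ξ, y) = V (ξ, x₀) + ∫ η in x₀..y, ∫ ξ', w (ξ', η) * a ξ' := by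
    intro y hy
    rw [← hK x₀ hx₀m y hy, ← integral_sub
      (ha.integrable_mul (K := fun ξ' => V (ξ', y)) (by fun_prop))
      (ha.integrable_mul (K := fun ξ' => V (ξ', x₀)) (by fun_prop))]
    have : ∀ ξ', V (ξ', y) * a ξ' - V (ξ', x₀) * a ξ' = (V (ξ, y) - V (ξ, x₀)) * a ξ' := by
      intro ξ'
      by_cases hξ' : ξ' ∈ Ioo α β
      · have := hP ξ hξ ξ' hξ' y hy x₀ hx₀m
        rw [← sub_mul]
        congr 1
        linarith
      · simp [ha.eq_zero hξ']
    simp only [this]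
    rw [integral_const_mul, ha1]
    ring
  filter_upwards [(hWi.intervalIntegrable (a := γ) (b := δ)).ae_hasDerivAt_integral] with η hη hηm
  have h1 := hη (by rw [uIcc_of_le hγδ.le]; exact Ioo_subset_Icc_self hηm) x₀
    (by rw [uIcc_of_le hγδ.le]; exact Ioo_subset_Icc_self hx₀m)
  have h2 := (h1.const_add (V (ξ, x₀))).differentiableAt
  refine h2.congr_of_eventuallyEq ?_
  filter_upwards [isOpen_Ioo.mem_nhds hηm] with y hy
  exact hEq y hy

/-! ### Characteristic coordinates and the weak wave equation -/

/-- Characteristic coordinates `(ξ, η) = (c t + x, c t - x)`. -/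
noncomputable def charEquiv (c : ℝ) (hc : c ≠ 0) : (ℝ × ℝ) ≃L[ℝ] (ℝ × ℝ) :=
  LinearEquiv.toContinuousLinearEquiv
    { toFun := fun p => (c * p.1 + p.2, c * p.1 - p.2)
      invFun := fun q => ((q.1 + q.2) / (2 * c), (q.1 - q.2) / 2)
      map_add' := fun p q => by
        ext <;> simp only [Prod.fst_add, Prod.snd_add] <;> ring
      map_smul' := fun r p => by
        ext <;> simp only [Prod.smul_fst, Prod.smul_snd, smul_eq_mul, RingHom.id_apply] <;> ring
      left_inv := fun p => by ext <;> simp only <;> field_simp <;> ring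
      right_inv := fun q => by ext <;> simp only <;> field_simp <;> ring }

theorem charEquiv_apply {c : ℝ} (hc : c ≠ 0) (p : ℝ × ℝ) :
    charEquiv c hc p = (c * p.1 + p.2, c * p.1 - p.2) := rfl

/-- A linear change of variables multiplies Lebesgue measure by a constant. -/
theorem exists_map_eq_smul (e : (ℝ × ℝ) ≃L[ℝ] (ℝ × ℝ)) :
    ∃ k : ℝ, 0 < k ∧ Measure.map e volume = ENNReal.ofReal k • (volume : Measure (ℝ × ℝ)) := by
  have hdet : LinearMap.det (e : (ℝ × ℝ) →ₗ[ℝ] (ℝ × ℝ)) ≠ 0 :=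
    (LinearEquiv.isUnit_det' e.toLinearEquiv).ne_zero
  exact ⟨|(LinearMap.det (e : (ℝ × ℝ) →ₗ[ℝ] (ℝ × ℝ)))⁻¹|, by positivity,
    Measure.map_linearMap_addHaar_eq_smul_addHaar volume hdet⟩

theorem exists_integral_comp (e : (ℝ × ℝ) ≃L[ℝ] (ℝ × ℝ)) :
    ∃ k : ℝ, 0 < k ∧ ∀ G : ℝ × ℝ → ℝ, ∫ p, G (e p) = k * ∫ q, G q := by
  obtain ⟨k, hk, hmap⟩ := exists_map_eq_smul e
  refine ⟨k, hk, fun G => ?_⟩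
  have h := (e.toHomeomorph.measurableEmbedding).integral_map (μ := volume) G
  have h2 : Measure.map e.toHomeomorph volume = ENNReal.ofReal k • (volume : Measure (ℝ × ℝ)) := hmap
  rw [h2, integral_smul_measure, ENNReal.toReal_ofReal hk.le] at h
  exact h.symm

theorem integrable_comp_equiv (e : (ℝ × ℝ) ≃L[ℝ] (ℝ × ℝ)) {G : ℝ × ℝ → ℝ} (hG : Integrable G) :
    Integrable fun p => G (e p) := by
  obtain ⟨k, hk, hmap⟩ := exists_map_eq_smul e
  have h2 : Measure.map e.toHomeomorph volume = ENNReal.ofReal k • (volume : Measure (ℝ × ℝ)) := hmap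
  refine ((e.toHomeomorph.measurableEmbedding).integrable_map_iff (μ := volume)).1 ?_
  rw [h2]
  exact hG.smul_measure (by simp)

/-- A product test function in characteristic coordinates. -/
def charTest (c : ℝ) (a b : ℝ → ℝ) (t x : ℝ) : ℝ := a (c * t + x) * b (c * t - x)

/-- The rectangle `[α, β] × [γ, δ]` of characteristic coordinates, as a subset of space-time. -/
def charRect (c α β γ δ : ℝ) : Set (ℝ × ℝ) :=
  {p | (c * p.1 + p.2, c * p.1 - p.2) ∈ Icc α β ×ˢ Icc γ δ}

theorem isCompact_charRect {c : ℝ} (hc : c ≠ 0) (α β γ δ : ℝ) :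
    IsCompact (charRect c α β γ δ) := by
  have h : IsCompact ((charEquiv c hc).toHomeomorph ⁻¹' (Icc α β ×ˢ Icc γ δ)) :=
    (charEquiv c hc).toHomeomorph.isCompact_preimage.2 (isCompact_Icc.prod isCompact_Icc)
  exact h

/-- The three inequalities are `t > 0`, `x > 0` and `x < L` at the corners of the rectangle where
each is tightest. -/
theorem charRect_subset_domain {c L α β γ δ : ℝ} (hc : 0 < c) (h1 : 0 < α + γ) (h2 : δ < α)
    (h3 : β - γ < 2 * L) : charRect c α β γ δ ⊆ domain L := by
  rintro ⟨t, x⟩ ⟨⟨h4, h5⟩, h6, h7⟩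
  simp only at h4 h5 h6 h7
  refine ⟨?_, ?_, ?_⟩
  · have : 0 < c * t := by linarith
    exact pos_of_mul_pos_right this hc.le
  · change 0 < x
    linarith
  · change x < L
    linarith

section

variable {c α β γ δ : ℝ} {a b : ℝ → ℝ}

theorem IsBump.charTest_eq_zero (ha : IsBump α β a) (hb : IsBump γ δ b) {p : ℝ × ℝ}
    (hp : p ∉ charRect c α β γ δ) : charTest c a b p.1 p.2 = 0 := by
  by_cases h : c * p.1 + p.2 ∈ Ioo α β
  · by_cases h' : c * p.1 - p.2 ∈ Ioo γ δ
    · exact absurd ⟨Ioo_subset_Icc_self h, Ioo_subset_Icc_self h'⟩ hp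
    · rw [charTest, hb.eq_zero h', mul_zero]
  · rw [charTest, ha.eq_zero h, zero_mul]

theorem IsBump.contDiff_charTest (ha : IsBump α β a) (hb : IsBump γ δ b) :
    ContDiff ℝ (⊤ : ℕ∞) (fun p : ℝ × ℝ => charTest c a b p.1 p.2) := by
  have := ha.contDiff
  have := hb.contDiff
  unfold charTest
  fun_prop

theorem IsBump.isTest_charTest {L : ℝ} (ha : IsBump α β a) (hb : IsBump γ δ b) (hc : 0 < c)
    (h1 : 0 < α + γ) (h2 : δ < α) (h3 : β - γ < 2 * L) : IsTest L (charTest c a b) := by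
  have hsub : tsupport (fun p : ℝ × ℝ => charTest c a b p.1 p.2) ⊆ charRect c α β γ δ :=
    closure_minimal (fun p hp => by
      by_contra hcon
      exact hp (ha.charTest_eq_zero hb hcon)) (isCompact_charRect hc.ne' _ _ _ _).isClosed
  refine ⟨(ha.contDiff_charTest hb).of_le (WithTop.coe_le_coe.2 le_top), ?_, ?_⟩
  · exact (isCompact_charRect hc.ne' _ _ _ _).of_isClosed_subset (isClosed_tsupport _) hsub
  · exact hsub.trans (charRect_subset_domain hc h1 h2 h3)

theorem IsBump.hasDerivAt (ha : IsBump α β a) (x : ℝ) : HasDerivAt a (_root_.deriv a x) x :=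
  ((ha.contDiff.differentiable (by simp)).differentiableAt).hasDerivAt

theorem IsBump.dt_charTest (ha : IsBump α β a) (hb : IsBump γ δ b) (p : ℝ × ℝ) :
    dt (charTest c a b) p =
      c * (charTest c (_root_.deriv a) b p.1 p.2 + charTest c a (_root_.deriv b) p.1 p.2) := by
  have hlin1 : HasDerivAt (fun t => c * t + p.2) c p.1 := by
    simpa using ((hasDerivAt_id p.1).const_mul c).add_const p.2
  have hlin2 : HasDerivAt (fun t => c * t - p.2) c p.1 := by
    simpa using ((hasDerivAt_id p.1).const_mul c).sub_const p.2
  have h := ((ha.hasDerivAt (c * p.1 + p.2)).comp p.1 hlin1).mul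
    ((hb.hasDerivAt (c * p.1 - p.2)).comp p.1 hlin2)
  refine h.deriv.trans ?_
  simp only [charTest, Function.comp]
  ring

theorem IsBump.dx_charTest (ha : IsBump α β a) (hb : IsBump γ δ b) (p : ℝ × ℝ) :
    dx (charTest c a b) p =
      charTest c (_root_.deriv a) b p.1 p.2 - charTest c a (_root_.deriv b) p.1 p.2 := by
  have hlin1 : HasDerivAt (fun x => c * p.1 + x) 1 p.2 := by
    simpa using (hasDerivAt_id p.2).const_add (c * p.1)
  have hlin2 : HasDerivAt (fun x => c * p.1 - x) (-1) p.2 := by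
    simpa using (hasDerivAt_id p.2).const_sub (c * p.1)
  have h := ((ha.hasDerivAt (c * p.1 + p.2)).comp p.2 hlin1).mul
    ((hb.hasDerivAt (c * p.1 - p.2)).comp p.2 hlin2)
  refine h.deriv.trans ?_
  simp only [charTest, Function.comp]
  ring

theorem IsBump.integrable_mul_charTest (ha : IsBump α β a) (hb : IsBump γ δ b) {u : ℝ × ℝ → ℝ}
    (hu : Integrable u) : Integrable fun p : ℝ × ℝ => u p * charTest c a b p.1 p.2 := by
  obtain ⟨C, hC⟩ := ha.exists_bound
  obtain ⟨D, hD⟩ := hb.exists_bound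
  refine hu.mul_bdd (c := C * D) (ha.contDiff_charTest hb).continuous.aestronglyMeasurable
    (Eventually.of_forall fun p => ?_)
  rw [charTest, norm_mul]
  exact mul_le_mul (hC _) (hD _) (norm_nonneg _) ((norm_nonneg _).trans (hC 0))

theorem IsBump.setIntegral_charTest {L : ℝ} (ha : IsBump α β a) (hb : IsBump γ δ b)
    (hR : charRect c α β γ δ ⊆ domain L) (u : ℝ × ℝ → ℝ) :
    ∫ p in domain L, u p * charTest c a b p.1 p.2 =
      ∫ p, (charRect c α β γ δ).indicator u p * charTest c a b p.1 p.2 := by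
  rw [setIntegral_eq_integral_of_forall_compl_eq_zero (fun p hp => by
    rw [ha.charTest_eq_zero hb fun h => hp (hR h), mul_zero])]
  refine integral_congr_ae (Eventually.of_forall fun p => ?_)
  by_cases hp : p ∈ charRect c α β γ δ
  · simp [hp]
  · simp [ha.charTest_eq_zero hb hp]

end

/-- The weak wave equation tested with products of functions of the characteristic coordinates. -/
theorem IsWeakWave.charTest {L c : ℝ} {v : ℝ → ℝ → ℝ} (hv : IsWeakWave L c v) (hc : 0 < c)
    (hvc : ContinuousOn (fun p : ℝ × ℝ => v p.1 p.2) (domain L))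
    {α β γ δ : ℝ} (h1 : 0 < α + γ) (h2 : δ < α) (h3 : β - γ < 2 * L) :
    ∃ w : ℝ × ℝ → ℝ, Integrable w ∧ ∀ a b, IsBump α β a → IsBump γ δ b →
      (∫ p in domain L, v p.1 p.2 * charTest c (deriv a) (deriv b) p.1 p.2 = 0) ∧
      (∫ p in domain L, v p.1 p.2 * charTest c a (deriv b) p.1 p.2 =
        -∫ p, w p * charTest c a b p.1 p.2) := by
  obtain ⟨vt, vx, hvt, hvx, ht, hx, hw⟩ := hv
  have hR := charRect_subset_domain (c := c) hc h1 h2 h3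
  have hK := isCompact_charRect hc.ne' α β γ δ
  have hm : MeasurableSet (charRect c α β γ δ) := hK.isClosed.measurableSet
  set R := charRect c α β γ δ with hRdef
  have iv : Integrable (R.indicator fun p : ℝ × ℝ => v p.1 p.2) :=
    ((hvc.mono hR).integrableOn_compact hK).integrable_indicator hm
  have it : Integrable (R.indicator vt) :=
    (hvt.integrableOn_compact_subset hR hK).integrable_indicator hm
  have ix : Integrable (R.indicator vx) :=
    (hvx.integrableOn_compact_subset hR hK).integrable_indicator hm
  set V := R.indicator fun p : ℝ × ℝ => v p.1 p.2
  set T := R.indicator vt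
  set X := R.indicator vx
  -- By the chain rule `∂_t = c (∂_ξ + ∂_η)` and `∂_x = ∂_ξ - ∂_η`. Cutting `u` off to the rectangle
  -- makes every integral one over the plane with an integrable factor.
  have comb : ∀ (u : ℝ × ℝ → ℝ), Integrable (R.indicator u) → ∀ a b, IsBump α β a → IsBump γ δ b →
      (∫ p in domain L, u p * dt (DelayedWave.charTest c a b) p =
        c * ((∫ p, R.indicator u p * DelayedWave.charTest c (deriv a) b p.1 p.2) +
          ∫ p, R.indicator u p * DelayedWave.charTest c a (deriv b) p.1 p.2)) ∧
      (∫ p in domain L, u p * dx (DelayedWave.charTest c a b) p =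
        (∫ p, R.indicator u p * DelayedWave.charTest c (deriv a) b p.1 p.2) -
          ∫ p, R.indicator u p * DelayedWave.charTest c a (deriv b) p.1 p.2) := by
    intro u hu a b ha hb
    have i1 := ha.deriv.integrable_mul_charTest (c := c) hb hu
    have i2 := ha.integrable_mul_charTest (c := c) hb.deriv hu
    have s1 := ha.deriv.setIntegral_charTest hb hR u
    have s2 := ha.setIntegral_charTest hb.deriv hR u
    have z : ∀ p ∉ domain L, DelayedWave.charTest c (deriv a) b p.1 p.2 = 0 ∧
        DelayedWave.charTest c a (deriv b) p.1 p.2 = 0 := fun p hp =>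
      ⟨ha.deriv.charTest_eq_zero hb fun h => hp (hR h),
        ha.charTest_eq_zero hb.deriv fun h => hp (hR h)⟩
    have r : ∀ p, R.indicator u p * DelayedWave.charTest c (deriv a) b p.1 p.2 =
          u p * DelayedWave.charTest c (deriv a) b p.1 p.2 ∧
        R.indicator u p * DelayedWave.charTest c a (deriv b) p.1 p.2 =
          u p * DelayedWave.charTest c a (deriv b) p.1 p.2 := by
      intro p
      by_cases hp : p ∈ R
      · simp [hp]
      · simp [ha.deriv.charTest_eq_zero hb hp, ha.charTest_eq_zero hb.deriv hp]
    constructor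
    · rw [setIntegral_eq_integral_of_forall_compl_eq_zero (fun p hp => by
        rw [ha.dt_charTest hb, (z p hp).1, (z p hp).2, add_zero, mul_zero, mul_zero]),
        ← integral_add i1 i2, ← integral_const_mul]
      refine integral_congr_ae (Eventually.of_forall fun p => ?_)
      simp only
      rw [ha.dt_charTest hb, (r p).1, (r p).2]
      ring
    · rw [setIntegral_eq_integral_of_forall_compl_eq_zero (fun p hp => by
        rw [ha.dx_charTest hb, (z p hp).1, (z p hp).2, sub_zero, mul_zero]),
        ← integral_sub i1 i2]
      refine integral_congr_ae (Eventually.of_forall fun p => ?_)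
      simp only
      rw [ha.dx_charTest hb, (r p).1, (r p).2]
      ring
  have et : ∀ a b, IsBump α β a → IsBump γ δ b →
      c * ((∫ p, V p * DelayedWave.charTest c (deriv a) b p.1 p.2) +
        ∫ p, V p * DelayedWave.charTest c a (deriv b) p.1 p.2) =
      -∫ p, T p * DelayedWave.charTest c a b p.1 p.2 := fun a b ha hb => by
    rw [← (comb _ iv a b ha hb).1, ht _ (ha.isTest_charTest hb hc h1 h2 h3),
      ha.setIntegral_charTest hb hR]
  have ex : ∀ a b, IsBump α β a → IsBump γ δ b →
      (∫ p, V p * DelayedWave.charTest c (deriv a) b p.1 p.2) -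
        ∫ p, V p * DelayedWave.charTest c a (deriv b) p.1 p.2 =
      -∫ p, X p * DelayedWave.charTest c a b p.1 p.2 := fun a b ha hb => by
    rw [← (comb _ iv a b ha hb).2, hx _ (ha.isTest_charTest hb hc h1 h2 h3),
      ha.setIntegral_charTest hb hR]
  -- This is the weak `∂_η v`, since `t = (ξ + η) / (2 c)` and `x = (ξ - η) / 2`.
  refine ⟨fun p => (1 / (2 * c)) * T p - (1 / 2) * X p,
    (it.const_mul _).sub (ix.const_mul _), fun a b ha hb => ⟨?_, ?_⟩⟩
  · rw [ha.deriv.setIntegral_charTest hb.deriv hR]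
    have e0 := hw _ (ha.isTest_charTest hb hc h1 h2 h3)
    rw [(comb _ it a b ha hb).1, (comb _ ix a b ha hb).2] at e0
    change c * ((∫ p, T p * DelayedWave.charTest c (deriv a) b p.1 p.2) +
        ∫ p, T p * DelayedWave.charTest c a (deriv b) p.1 p.2) =
      c ^ 2 * ((∫ p, X p * DelayedWave.charTest c (deriv a) b p.1 p.2) -
        ∫ p, X p * DelayedWave.charTest c a (deriv b) p.1 p.2) at e0
    have e1 := et _ _ ha.deriv hb
    have e2 := et _ _ ha hb.deriv
    have e3 := ex _ _ ha.deriv hb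
    have e4 := ex _ _ ha hb.deriv
    have hc2 : c ^ 2 ≠ 0 := by positivity
    -- The weak form of `∂_t² - c² ∂_x² = 4 c² ∂_ξ ∂_η`: the terms containing `a''` and `b''`
    -- cancel.
    have : c ^ 2 * (4 * ∫ p, V p * DelayedWave.charTest c (deriv a) (deriv b) p.1 p.2) = 0 := by
      linear_combination c * e1 + c * e2 - c ^ 2 * e3 + c ^ 2 * e4 - e0
    have := (mul_eq_zero.1 this).resolve_left hc2
    change ∫ p, V p * DelayedWave.charTest c (deriv a) (deriv b) p.1 p.2 = 0
    linarith
  · rw [ha.setIntegral_charTest hb.deriv hR]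
    have e1 := et _ _ ha hb
    have e2 := ex _ _ ha hb
    have e3 : ∫ p, ((1 / (2 * c)) * T p - (1 / 2) * X p) * DelayedWave.charTest c a b p.1 p.2 =
        (1 / (2 * c)) * (∫ p, T p * DelayedWave.charTest c a b p.1 p.2) -
        (1 / 2) * ∫ p, X p * DelayedWave.charTest c a b p.1 p.2 := by
      rw [← integral_const_mul, ← integral_const_mul, ← integral_sub
        ((ha.integrable_mul_charTest hb it).const_mul _)
        ((ha.integrable_mul_charTest hb ix).const_mul _)]
      refine integral_congr_ae (Eventually.of_forall fun p => ?_)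
      simp only
      ring
    rw [e3]
    change ∫ p, V p * DelayedWave.charTest c a (deriv b) p.1 p.2 = _
    rw [← sub_eq_zero]
    field_simp
    linear_combination e1 - c * e2

/-! ### Building the profile by reflection at the two ends -/

/-- A function on the strip `0 ≤ ξ + η`, `0 ≤ ξ - η ≤ 2 L` that satisfies the parallelogram
identity and vanishes on the diagonal is a difference `F ξ - F η`. -/
theorem exists_profile {L : ℝ} (hL : 0 < L) {V : ℝ → ℝ → ℝ}
    (hV : ∀ ξ₁ ξ₂ η₁ η₂ : ℝ, (∀ ξ ∈ ({ξ₁, ξ₂} : Set ℝ), ∀ η ∈ ({η₁, η₂} : Set ℝ),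
      0 ≤ ξ + η ∧ 0 ≤ ξ - η ∧ ξ - η ≤ 2 * L) → V ξ₁ η₁ + V ξ₂ η₂ = V ξ₁ η₂ + V ξ₂ η₁)
    (h0 : ∀ η, 0 ≤ η → V η η = 0) :
    ∃ F : ℝ → ℝ, ∀ ξ η, 0 ≤ ξ + η → 0 ≤ ξ - η → ξ - η ≤ 2 * L → V ξ η = F ξ - F η := by
  -- Normalised by `F 0 = 0`, the values on `[0, 2 L]` are read off `η = 0` and the negative ones
  -- off the line `t = 0`. Beyond `2 L`, the trace at `x = L` gives `F s = F (s - 2 L) + V s (s - 2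
  -- L)`, applied `N s` times.
  let base : ℝ → ℝ := fun s => if 0 ≤ s then V s 0 else V (-s) 0 - V (-s) s
  let N : ℝ → ℕ := fun s => ⌈(s - 2 * L) / (2 * L)⌉₊
  let F : ℝ → ℝ := fun s => base (s - 2 * L * N s) +
    ∑ k ∈ Finset.range (N s), V (s - 2 * L * k) (s - 2 * L * k - 2 * L)
  have hF1 : ∀ s ≤ 2 * L, F s = base s := by
    intro s hs
    have : N s = 0 := Nat.ceil_eq_zero.2 (div_nonpos_of_nonpos_of_nonneg (by linarith) (by linarith))
    simp [F, this]
  have hF2 : ∀ s, 2 * L < s → F s = F (s - 2 * L) + V s (s - 2 * L) := by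
    intro s hs
    have hN : N s = N (s - 2 * L) + 1 := by
      have h1 : (s - 2 * L) / (2 * L) = (s - 2 * L - 2 * L) / (2 * L) + 1 := by field_simp; ring
      have h2 : 0 < (s - 2 * L) / (2 * L) := div_pos (by linarith) (by linarith)
      change ⌈(s - 2 * L) / (2 * L)⌉₊ = ⌈(s - 2 * L - 2 * L) / (2 * L)⌉₊ + 1
      rcases le_or_gt 0 ((s - 2 * L - 2 * L) / (2 * L)) with h3 | h3
      · rw [h1, Nat.ceil_add_one h3]
      · rw [Nat.ceil_eq_zero.2 h3.le, zero_add, Nat.ceil_eq_iff (by simp)]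
        constructor
        · simpa using h2
        · push_cast
          linarith
    simp only [F, hN]
    rw [Finset.sum_range_succ']
    push_cast
    have e1 : s - 2 * L * ((N (s - 2 * L) : ℝ) + 1) = s - 2 * L - 2 * L * N (s - 2 * L) := by ring
    have e2 : ∀ k : ℕ, s - 2 * L * ((k : ℝ) + 1) = s - 2 * L - 2 * L * k := fun k => by ring
    simp only [e1, e2, mul_zero, sub_zero]
    ring
  have hsmall : ∀ ξ η, ξ ≤ 2 * L → 0 ≤ ξ + η → 0 ≤ ξ - η → ξ - η ≤ 2 * L →
      V ξ η = F ξ - F η := by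
    intro ξ η h h1 h2 h3
    rw [hF1 ξ h, hF1 η (by linarith)]
    simp only [base]
    rw [if_pos (by linarith : 0 ≤ ξ)]
    split_ifs with hη
    · have := hV ξ η η 0 (by
        rintro x (rfl | rfl) y (rfl | rfl) <;> refine ⟨?_, ?_, ?_⟩ <;> linarith)
      rw [h0 η hη] at this
      linarith
    · push Not at hη
      have := hV ξ (-η) η 0 (by
        rintro x (rfl | rfl) y (rfl | rfl) <;> refine ⟨?_, ?_, ?_⟩ <;> linarith)
      linarith
  -- Induction on time: the parallelogram with one corner on the diagonal, where `V` vanishes, and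
  -- one at the right end replaces `(ξ, η)` by `(η, ξ - 2 L)`, whose coordinate sum is smaller by `2
  -- L`.
  have hall : ∀ n : ℕ, ∀ ξ η, ξ + η ≤ 2 * L * n → 0 ≤ ξ + η → 0 ≤ ξ - η → ξ - η ≤ 2 * L →
      V ξ η = F ξ - F η := by
    intro n
    induction n with
    | zero =>
      intro ξ η h h1 h2 h3
      refine hsmall ξ η ?_ h1 h2 h3
      simp only [CharP.cast_eq_zero, mul_zero] at h
      linarith
    | succ n ih =>
      intro ξ η h h1 h2 h3
      rcases le_or_gt ξ (2 * L) with hξ | hξ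
      · exact hsmall ξ η hξ h1 h2 h3
      · push_cast at h
        have e1 := ih η (ξ - 2 * L) (by linarith) (by linarith) (by linarith) (by linarith)
        have e2 := hV ξ η η (ξ - 2 * L) (by
          rintro x (rfl | rfl) y (rfl | rfl) <;> refine ⟨?_, ?_, ?_⟩ <;> linarith)
        rw [h0 η (by linarith)] at e2
        rw [hF2 ξ hξ]
        linarith
  refine ⟨F, fun ξ η h1 h2 h3 => ?_⟩
  obtain ⟨n, hn⟩ := exists_nat_ge ((ξ + η) / (2 * L))
  refine hall n ξ η ?_ h1 h2 h3
  rw [div_le_iff₀ (by linarith)] at hn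
  linarith

/-! ### d'Alembert's formula for weak solutions -/

/-- The continuous extension of a function on `[0, ∞) × [0, L]` that is constant along the
projection onto this strip, in characteristic coordinates. -/
noncomputable def charExt (L c : ℝ) (v : ℝ → ℝ → ℝ) (q : ℝ × ℝ) : ℝ :=
  v (max ((q.1 + q.2) / (2 * c)) 0) (max 0 (min ((q.1 - q.2) / 2) L))

theorem continuous_charExt {L c : ℝ} (hL : 0 < L) {v : ℝ → ℝ → ℝ}
    (hv : ContinuousOn (fun p : ℝ × ℝ => v p.1 p.2) (Ici 0 ×ˢ Icc 0 L)) :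
    Continuous (charExt L c v) := by
  have h : Continuous fun q : ℝ × ℝ =>
      (max ((q.1 + q.2) / (2 * c)) 0, max 0 (min ((q.1 - q.2) / 2) L)) := by fun_prop
  exact hv.comp_continuous h fun q =>
    ⟨mem_Ici.2 (le_max_right _ _), mem_Icc.2 ⟨le_max_left _ _, max_le hL.le (min_le_right _ _)⟩⟩

theorem charExt_eq {L c : ℝ} (hc : 0 < c) {v : ℝ → ℝ → ℝ} {ξ η : ℝ} (h1 : 0 ≤ ξ + η)
    (h2 : 0 ≤ ξ - η) (h3 : ξ - η ≤ 2 * L) :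
    charExt L c v (ξ, η) = v ((ξ + η) / (2 * c)) ((ξ - η) / 2) := by
  have e1 : 0 ≤ (ξ + η) / (2 * c) := by positivity
  rw [charExt, max_eq_left e1, min_eq_left (by linarith), max_eq_right (by linarith)]

section

variable {L c : ℝ} {v : ℝ → ℝ → ℝ}

/-- Transports the tested equation to the `(ξ, η)` plane; the Jacobian is a positive constant and
cancels. Working with the extension supplies continuity on the whole plane, while the test functions
only see the original strip. -/
theorem IsWeakWave.charExt (hv : IsWeakWave L c v) (hc : 0 < c)
    (hvc : ContinuousOn (fun p : ℝ × ℝ => v p.1 p.2) (Ici 0 ×ˢ Icc 0 L))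
    {α β γ δ : ℝ} (h1 : 0 < α + γ) (h2 : δ < α) (h3 : β - γ < 2 * L) :
    ∃ w : ℝ × ℝ → ℝ, Integrable w ∧ ∀ a b, IsBump α β a → IsBump γ δ b →
      (∫ q : ℝ × ℝ, charExt L c v q * (deriv a q.1 * deriv b q.2) = 0) ∧
      (∫ q : ℝ × ℝ, charExt L c v q * (a q.1 * deriv b q.2) =
        -∫ q : ℝ × ℝ, w q * (a q.1 * b q.2)) := by
  have hsub : domain L ⊆ Ici 0 ×ˢ Icc 0 L := fun p hp =>
    ⟨mem_Ici.2 (le_of_lt (mem_Ioi.1 hp.1)), Ioo_subset_Icc_self hp.2⟩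
  obtain ⟨w, hw, hab⟩ := hv.charTest hc (hvc.mono hsub) h1 h2 h3
  set e := charEquiv c hc.ne' with he
  obtain ⟨k, hk, hint⟩ := exists_integral_comp e
  have hR := charRect_subset_domain (c := c) hc h1 h2 h3
  have tr : ∀ a b, IsBump α β a → IsBump γ δ b →
      ∫ p in domain L, v p.1 p.2 * DelayedWave.charTest c a b p.1 p.2 =
        k * ∫ q : ℝ × ℝ, DelayedWave.charExt L c v q * (a q.1 * b q.2) := by
    intro a b ha hb
    rw [← hint, ha.setIntegral_charTest hb hR]
    refine integral_congr_ae (Eventually.of_forall fun p => ?_)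
    simp only [he, charEquiv_apply]
    by_cases hp : p ∈ charRect c α β γ δ
    · have hd := hsub (hR hp)
      rw [indicator_of_mem hp, charExt_eq hc]
      · rw [DelayedWave.charTest]
        congr 2
        · field_simp
          ring
        · ring
      · have : 0 ≤ c * p.1 := mul_nonneg hc.le hd.1
        linarith
      · linarith [hd.2.1]
      · linarith [hd.2.2]
    · have hz := ha.charTest_eq_zero hb hp
      rw [hz]
      rw [DelayedWave.charTest] at hz
      rw [hz, mul_zero, mul_zero]
  have tr' : ∀ a b, ∫ p, w p * DelayedWave.charTest c a b p.1 p.2 =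
      k * ∫ q : ℝ × ℝ, w (e.symm q) * (a q.1 * b q.2) := by
    intro a b
    rw [← hint]
    refine integral_congr_ae (Eventually.of_forall fun p => ?_)
    simp only [ContinuousLinearEquiv.symm_apply_apply]
    rfl
  refine ⟨fun q => w (e.symm q), integrable_comp_equiv e.symm hw, fun a b ha hb => ⟨?_, ?_⟩⟩
  · have h := (hab a b ha hb).1
    rw [tr _ _ ha.deriv hb.deriv] at h
    exact (mul_eq_zero.1 h).resolve_left hk.ne'
  · have h := (hab a b ha hb).2
    rw [tr _ _ ha hb.deriv, tr', ← mul_neg] at h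
    exact mul_left_cancel₀ hk.ne' h

theorem IsWeakWave.parallelogram_of_rect (hv : IsWeakWave L c v) (hL : 0 < L) (hc : 0 < c)
    (hvc : ContinuousOn (fun p : ℝ × ℝ => v p.1 p.2) (Ici 0 ×ˢ Icc 0 L))
    {α β γ δ : ℝ} (h1 : 0 < α + γ) (h2 : δ < α) (h3 : β - γ < 2 * L)
    {ξ₁ ξ₂ η₁ η₂ : ℝ} (hξ₁ : ξ₁ ∈ Ioo α β) (hξ₂ : ξ₂ ∈ Ioo α β) (hη₁ : η₁ ∈ Ioo γ δ)
    (hη₂ : η₂ ∈ Ioo γ δ) :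
    DelayedWave.charExt L c v (ξ₁, η₁) + DelayedWave.charExt L c v (ξ₂, η₂) =
      DelayedWave.charExt L c v (ξ₁, η₂) + DelayedWave.charExt L c v (ξ₂, η₁) := by
  obtain ⟨w, hw, hab⟩ := hv.charExt hc hvc h1 h2 h3
  exact parallelogram_of_weak (continuous_charExt hL hvc) (fun a b ha hb => (hab a b ha hb).1)
    hξ₁ hξ₂ hη₁ hη₂

theorem exists_pos_lt_three {x y z : ℝ} (hx : 0 < x) (hy : 0 < y) (hz : 0 < z) :
    ∃ ε > 0, 2 * ε < x ∧ 2 * ε < y ∧ 2 * ε < z := by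
  have h : 0 < min x (min y z) := lt_min hx (lt_min hy hz)
  refine ⟨min x (min y z) / 4, by linarith, ?_, ?_, ?_⟩
  · linarith [min_le_left x (min y z)]
  · linarith [min_le_right x (min y z), min_le_left y z]
  · linarith [min_le_right x (min y z), min_le_right y z]

/-- Only the extreme corners matter for the strict inequalities, so they survive enlarging the
rectangle by a small `ε`, which puts all four points in an open rectangle. -/
theorem IsWeakWave.parallelogram_of_lt (hv : IsWeakWave L c v) (hL : 0 < L) (hc : 0 < c)
    (hvc : ContinuousOn (fun p : ℝ × ℝ => v p.1 p.2) (Ici 0 ×ˢ Icc 0 L))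
    {ξ₁ ξ₂ η₁ η₂ : ℝ} (h : ∀ ξ ∈ ({ξ₁, ξ₂} : Set ℝ), ∀ η ∈ ({η₁, η₂} : Set ℝ),
      0 < ξ + η ∧ 0 < ξ - η ∧ ξ - η < 2 * L) :
    DelayedWave.charExt L c v (ξ₁, η₁) + DelayedWave.charExt L c v (ξ₂, η₂) =
      DelayedWave.charExt L c v (ξ₁, η₂) + DelayedWave.charExt L c v (ξ₂, η₁) := by
  have m1 : min ξ₁ ξ₂ ∈ ({ξ₁, ξ₂} : Set ℝ) := by
    rcases min_choice ξ₁ ξ₂ with e | e <;> simp [e]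
  have m2 : max ξ₁ ξ₂ ∈ ({ξ₁, ξ₂} : Set ℝ) := by
    rcases max_choice ξ₁ ξ₂ with e | e <;> simp [e]
  have m3 : min η₁ η₂ ∈ ({η₁, η₂} : Set ℝ) := by
    rcases min_choice η₁ η₂ with e | e <;> simp [e]
  have m4 : max η₁ η₂ ∈ ({η₁, η₂} : Set ℝ) := by
    rcases max_choice η₁ η₂ with e | e <;> simp [e]
  have i1 := (h _ m1 _ m3).1
  have i2 := (h _ m1 _ m4).2.1
  have i3 := (h _ m2 _ m3).2.2
  obtain ⟨ε, hε, j1, j2, j3⟩ := exists_pos_lt_three i1 i2 (sub_pos.2 i3)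
  refine hv.parallelogram_of_rect hL hc hvc (α := min ξ₁ ξ₂ - ε) (β := max ξ₁ ξ₂ + ε)
    (γ := min η₁ η₂ - ε) (δ := max η₁ η₂ + ε) (by linarith) (by linarith) (by linarith)
    ⟨?_, ?_⟩ ⟨?_, ?_⟩ ⟨?_, ?_⟩ ⟨?_, ?_⟩
  · linarith [min_le_left ξ₁ ξ₂]
  · linarith [le_max_left ξ₁ ξ₂]
  · linarith [min_le_right ξ₁ ξ₂]
  · linarith [le_max_right ξ₁ ξ₂]
  · linarith [min_le_left η₁ η₂]
  · linarith [le_max_left η₁ η₂]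
  · linarith [min_le_right η₁ η₂]
  · linarith [le_max_right η₁ η₂]

/-- The boundary case follows by continuity: contracting towards the interior point `(ξ, η) = (L,
0)` moves every configuration strictly inside for `0 < s < 1`, and then `s → 0`. -/
theorem IsWeakWave.parallelogram (hv : IsWeakWave L c v) (hL : 0 < L) (hc : 0 < c)
    (hvc : ContinuousOn (fun p : ℝ × ℝ => v p.1 p.2) (Ici 0 ×ˢ Icc 0 L))
    {ξ₁ ξ₂ η₁ η₂ : ℝ} (h : ∀ ξ ∈ ({ξ₁, ξ₂} : Set ℝ), ∀ η ∈ ({η₁, η₂} : Set ℝ),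
      0 ≤ ξ + η ∧ 0 ≤ ξ - η ∧ ξ - η ≤ 2 * L) :
    DelayedWave.charExt L c v (ξ₁, η₁) + DelayedWave.charExt L c v (ξ₂, η₂) =
      DelayedWave.charExt L c v (ξ₁, η₂) + DelayedWave.charExt L c v (ξ₂, η₁) := by
  have hE := continuous_charExt (c := c) hL hvc
  let X : ℝ → ℝ → ℝ := fun ξ s => (1 - s) * ξ + s * L
  let Y : ℝ → ℝ → ℝ := fun η s => (1 - s) * η
  have hcl : IsClosed {s : ℝ | DelayedWave.charExt L c v (X ξ₁ s, Y η₁ s) +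
      DelayedWave.charExt L c v (X ξ₂ s, Y η₂ s) = DelayedWave.charExt L c v (X ξ₁ s, Y η₂ s) +
        DelayedWave.charExt L c v (X ξ₂ s, Y η₁ s)} :=
    isClosed_eq (by fun_prop) (by fun_prop)
  have hsub : Ioo (0 : ℝ) 1 ⊆ {s : ℝ | DelayedWave.charExt L c v (X ξ₁ s, Y η₁ s) +
      DelayedWave.charExt L c v (X ξ₂ s, Y η₂ s) = DelayedWave.charExt L c v (X ξ₁ s, Y η₂ s) +
        DelayedWave.charExt L c v (X ξ₂ s, Y η₁ s)} := by
    intro s hs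
    have key : ∀ ξ η, 0 ≤ ξ + η → 0 ≤ ξ - η → ξ - η ≤ 2 * L →
        0 < X ξ s + Y η s ∧ 0 < X ξ s - Y η s ∧ X ξ s - Y η s < 2 * L := by
      intro ξ η k1 k2 k3
      have p1 := mul_nonneg (sub_nonneg.2 hs.2.le) k1
      have p2 := mul_nonneg (sub_nonneg.2 hs.2.le) k2
      have p3 := mul_nonneg (sub_nonneg.2 hs.2.le) (sub_nonneg.2 k3)
      have p4 := mul_pos hs.1 hL
      refine ⟨?_, ?_, ?_⟩ <;> simp only [X, Y] <;> linarith
    refine hv.parallelogram_of_lt hL hc hvc ?_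
    rintro ξ (rfl | rfl) η (rfl | rfl)
    · have := h ξ₁ (by simp) η₁ (by simp); exact key _ _ this.1 this.2.1 this.2.2
    · have := h ξ₁ (by simp) η₂ (by simp); exact key _ _ this.1 this.2.1 this.2.2
    · have := h ξ₂ (by simp) η₁ (by simp); exact key _ _ this.1 this.2.1 this.2.2
    · have := h ξ₂ (by simp) η₂ (by simp); exact key _ _ this.1 this.2.1 this.2.2
  have h0 := closure_minimal hsub hcl
  rw [closure_Ioo zero_ne_one] at h0
  have h1 := h0 (⟨le_rfl, zero_le_one⟩ : (0 : ℝ) ∈ Icc (0 : ℝ) 1)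
  simpa [X, Y] using h1

/-- **d'Alembert's formula** on the half-strip: a weak solution with `v = 0` at the left end is
`F (c t + x) - F (c t - x)` with `F` differentiable almost everywhere on `(-L, ∞)`. -/
theorem IsWeakWave.exists_profile (hv : IsWeakWave L c v) (hL : 0 < L) (hc : 0 < c)
    (hvc : ContinuousOn (fun p : ℝ × ℝ => v p.1 p.2) (Ici 0 ×ˢ Icc 0 L))
    (hleft : ∀ t ≥ 0, v t 0 = 0) :
    ∃ F : ℝ → ℝ, (∀ t ≥ 0, ∀ x ∈ Icc 0 L, v t x = F (c * t + x) - F (c * t - x)) ∧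
      ∀ᵐ s, -L < s → DifferentiableAt ℝ F s := by
  obtain ⟨F, hF⟩ := DelayedWave.exists_profile hL
    (V := fun ξ η => DelayedWave.charExt L c v (ξ, η))
    (fun ξ₁ ξ₂ η₁ η₂ h => hv.parallelogram hL hc hvc h) (fun η hη => by
      rw [charExt_eq hc (by linarith) (by linarith) (by linarith), sub_self, zero_div]
      exact hleft _ (by positivity))
  refine ⟨F, fun t ht x hx => ?_, ?_⟩
  · have h0 : 0 ≤ c * t := mul_nonneg hc.le ht
    rw [← hF _ _ (by linarith) (by linarith [hx.1]) (by linarith [hx.2]),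
      charExt_eq hc (by linarith) (by linarith [hx.1]) (by linarith [hx.2])]
    congr 1
    · field_simp
      ring
    · ring
  · rw [ae_iff]
    refine measure_null_of_locally_null _ fun s hs => ?_
    simp only [Classical.not_imp, mem_ofPred_eq] at hs
    have hs1 := hs.1
    -- The midpoint of the interval `(|s|, s + 2 L)` of those `ξ` for which `(ξ, s)` lies inside the
    -- strip; it is nonempty because `s > -L`. Near `s`, `F` is then a constant minus `V (ξ₀, ·)`.
    set ξ₀ := (|s| + s) / 2 + L with hξ₀
    have a1 := neg_abs_le s
    have a2 := le_abs_self s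
    have a3 : |s| < s + 2 * L := abs_lt.2 ⟨by linarith, by linarith⟩
    obtain ⟨ε, hε, j1, j2, j3⟩ := exists_pos_lt_three (x := ξ₀ + s) (y := ξ₀ - s)
      (z := 2 * L - (ξ₀ - s)) (by
        rcases abs_cases s with h | h <;> linarith) (by
        rcases abs_cases s with h | h <;> linarith) (by
        rcases abs_cases s with h | h <;> linarith)
    have k1 : 0 < (ξ₀ - ε) + (s - ε) := by linarith
    have k2 : s + ε < ξ₀ - ε := by linarith
    have k3 : (ξ₀ + ε) - (s - ε) < 2 * L := by linarith
    obtain ⟨w, hw, hab⟩ := hv.charExt hc hvc k1 k2 k3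
    have hd := ae_differentiableAt_of_weak (continuous_charExt (c := c) hL hvc) hw
      (fun ξ₁ e1 ξ₂ e2 η₁ e3 η₂ e4 => hv.parallelogram_of_rect hL hc hvc k1 k2 k3 e1 e2 e3 e4)
      (fun a b ha hb => (hab a b ha hb).2) (ξ := ξ₀) ⟨by linarith, by linarith⟩
    refine ⟨{η | ¬ (η ∈ Ioo (s - ε) (s + ε) → DifferentiableAt ℝ F η)}, ?_, ?_⟩
    · filter_upwards [self_mem_nhdsWithin,
        mem_nhdsWithin_of_mem_nhds (Ioo_mem_nhds (by linarith : s - ε < s) (by linarith : s < s + ε))]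
        with η hη hη'
      exact fun h => hη fun _ => h hη'
    · rw [← ae_iff]
      filter_upwards [hd] with η hη hη'
      have h2 := (hη hη').const_sub (F ξ₀)
      refine h2.congr_of_eventuallyEq ?_
      filter_upwards [isOpen_Ioo.mem_nhds hη'] with y hy
      rw [hF ξ₀ y (by linarith [hy.1]) (by linarith [hy.2]) (by linarith [hy.1])]
      ring

end

/-! ### The scalar recursion with switching delay -/

/-- A small delayed negative feedback on the increments makes a scalar recursion contract
geometrically, whichever of the two delays is active at each step. -/
theorem abs_le_of_delayed_recursion {h : ℝ} (h0 : 0 < h) (h1 : h ≤ 1 / 22) {a : ℕ → ℝ}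
    (ha0 : ∀ n < 4, a (n + 1) = a n)
    (ha : ∀ n, a (n + 5) = a (n + 4) - h * (a (n + 3) + a (n + 2)) ∨
      a (n + 5) = a (n + 4) - h * (a (n + 1) + a n)) (n : ℕ) :
    |a n| ≤ |a 0| / (1 - h) ^ 4 * (1 - h) ^ n := by
  set κ := 1 - h with hκ
  have hκ0 : 0 < κ := by linarith
  have hκ1 : κ ≤ 1 := by linarith
  -- The factor `κ⁻⁴` lets the geometric bound cover the five equal initial terms.
  set B := |a 0| / κ ^ 4 with hB
  have hB0 : 0 ≤ B := by positivity
  have e1 : a 1 = a 0 := ha0 0 (by norm_num)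
  have e2 : a 2 = a 0 := (ha0 1 (by norm_num)).trans e1
  have e3 : a 3 = a 0 := (ha0 2 (by norm_num)).trans e2
  have e4 : a 4 = a 0 := (ha0 3 (by norm_num)).trans e3
  have hbase : ∀ k ≤ 4, |a 0| ≤ B * κ ^ k := by
    intro k hk
    rw [hB, div_mul_eq_mul_div, le_div_iff₀ (by positivity)]
    exact mul_le_mul_of_nonneg_left (pow_le_pow_of_le_one hκ0.le hκ1 hk) (abs_nonneg _)
  -- Bernoulli gives `κ ^ 8 ≥ 1 - 8 h`, which is at least `14 h` exactly when `h ≤ 1 / 22`: the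
  -- source of that threshold.
  have hκ8 : 14 * h ≤ κ ^ 8 := by
    have : 1 + (8 : ℕ) * (-h) ≤ (1 + -h) ^ 8 := one_add_mul_le_pow (by linarith) 8
    push_cast at this
    rw [← sub_eq_add_neg, ← hκ] at this
    linarith
  induction n using Nat.strong_induction_on with
  | _ n ih =>
    rcases Nat.lt_or_ge n 5 with hn | hn
    · have : a n = a 0 := by interval_cases n <;> first | rfl | assumption
      rw [this]
      exact hbase n (by omega)
    · obtain ⟨m, rfl⟩ : ∃ m, n = m + 5 := ⟨n - 5, by omega⟩
      -- `M` bounds the window of the last eight terms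
      set P := B * κ ^ (m + 4) with hP
      set M := P / κ ^ 8 with hM
      have hP0 : 0 ≤ P := by positivity
      have hMP : P = M * κ ^ 8 := by rw [hM]; field_simp
      have hM0 : 0 ≤ M := by positivity
      have hwin : ∀ k, k ≤ m + 4 → m + 4 ≤ k + 8 → |a k| ≤ M := by
        intro k hk1 hk2
        refine (ih k (by omega)).trans ?_
        rw [hM, le_div_iff₀ (by positivity), hP, mul_assoc, ← pow_add]
        exact mul_le_mul_of_nonneg_left (pow_le_pow_of_le_one hκ0.le hκ1 (by omega)) hB0
      -- Each increment is zero or `h` times two terms of the window. The longer delay, starting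
      -- from `k = m`, reaches back to index `m - 4`, eight below `m + 4`; hence `κ ^ 8` in `M`.
      have hstep : ∀ k, k < m + 4 → m ≤ k → |a (k + 1) - a k| ≤ 2 * h * M := by
        intro k hk1 hk2
        rcases Nat.lt_or_ge k 4 with hk | hk
        · rw [ha0 k hk, sub_self, abs_zero]
          positivity
        · obtain ⟨j, rfl⟩ : ∃ j, k = j + 4 := ⟨k - 4, by omega⟩
          rcases ha j with hj | hj
          · rw [show j + 4 + 1 = j + 5 from rfl, hj, sub_sub_cancel_left, abs_neg, abs_mul,
              abs_of_pos h0]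
            have b1 := hwin (j + 3) (by omega) (by omega)
            have b2 := hwin (j + 2) (by omega) (by omega)
            have b3 := abs_add_le (a (j + 3)) (a (j + 2))
            nlinarith
          · rw [show j + 4 + 1 = j + 5 from rfl, hj, sub_sub_cancel_left, abs_neg, abs_mul,
              abs_of_pos h0]
            have b1 := hwin (j + 1) (by omega) (by omega)
            have b2 := hwin j (by omega) (by omega)
            have b3 := abs_add_le (a (j + 1)) (a j)
            nlinarith
      have s0 := abs_le.1 (hstep m (by omega) le_rfl)
      have s1 := abs_le.1 (hstep (m + 1) (by omega) (by omega))
      have s2 := abs_le.1 (hstep (m + 2) (by omega) (by omega))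
      have s3 := abs_le.1 (hstep (m + 3) (by omega) (by omega))
      simp only [add_assoc, Nat.reduceAdd] at s0 s1 s2 s3
      have hcur := abs_le.1 (ih (m + 4) (by omega))
      have hhM : 14 * h * (h * M) ≤ h * P := by
        rw [hMP]
        have := mul_le_mul_of_nonneg_right hκ8 (mul_nonneg h0.le hM0)
        linarith
      have hgoal : |a (m + 5)| ≤ (1 - 2 * h) * P + h * P := by
        -- `D` telescopes into increments: three for the short delay, and `3 + 4 = 7` for the long
        -- one, each at most `2 h M`.
        have hD : ∃ D, a (m + 5) = (1 - 2 * h) * a (m + 4) + h * D ∧ |D| ≤ 14 * h * M := by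
          rcases ha m with hm | hm
          · refine ⟨2 * a (m + 4) - a (m + 3) - a (m + 2), by rw [hm]; ring, ?_⟩
            have : 0 ≤ h * M := by positivity
            rw [abs_le]
            constructor <;> linarith
          · refine ⟨2 * a (m + 4) - a (m + 1) - a m, by rw [hm]; ring, ?_⟩
            rw [abs_le]
            constructor <;> linarith
        obtain ⟨D, hD1, hD2⟩ := hD
        rw [hD1]
        refine (abs_add_le _ _).trans (add_le_add ?_ ?_)
        · rw [abs_mul, abs_of_nonneg (by linarith : 0 ≤ 1 - 2 * h)]
          exact mul_le_mul_of_nonneg_left (ih (m + 4) (by omega)) (by linarith)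
        · rw [abs_mul, abs_of_pos h0]
          have := mul_le_mul_of_nonneg_left hD2 h0.le
          linarith
      refine hgoal.trans (le_of_eq ?_)
      rw [hP, hκ]
      ring

/-! ### Energy, initial data and boundary conditions in terms of the profile -/

theorem ae_affine {P : ℝ → Prop} (h : ∀ᵐ s, P s) {c : ℝ} (hc : c ≠ 0) (d : ℝ) :
    ∀ᵐ t, P (c * t + d) := by
  have h1 : ∀ᵐ s, P (s + d) := (measurePreserving_add_right volume d).quasiMeasurePreserving.ae h
  rw [ae_iff] at h1 ⊢
  have := Real.volume_preimage_mul_left hc {s | ¬ P (s + d)}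
  rw [h1, mul_zero] at this
  exact this

section

variable {L c : ℝ} {v : ℝ → ℝ → ℝ} {F : ℝ → ℝ}

theorem hasDerivWithinAt_space
    (hF : ∀ t ≥ 0, ∀ x ∈ Icc 0 L, v t x = F (c * t + x) - F (c * t - x)) {t x : ℝ} (ht : 0 ≤ t)
    (hx : x ∈ Icc 0 L) (h1 : DifferentiableAt ℝ F (c * t + x))
    (h2 : DifferentiableAt ℝ F (c * t - x)) :
    HasDerivWithinAt (fun ξ => v t ξ) (deriv F (c * t + x) + deriv F (c * t - x)) (Icc 0 L) x := by
  have d1 : HasDerivAt (fun ξ => F (c * t + ξ)) (deriv F (c * t + x)) x :=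
    h1.hasDerivAt.comp_const_add _ _
  have d2 : HasDerivAt (fun ξ => F (c * t - ξ)) (-deriv F (c * t - x)) x :=
    h2.hasDerivAt.comp_const_sub _ _
  have d3 := (d1.sub d2).hasDerivWithinAt (s := Icc 0 L)
  rw [sub_neg_eq_add] at d3
  exact d3.congr (fun y hy => hF t ht y hy) (hF t ht x hx)

theorem hasDerivWithinAt_time
    (hF : ∀ t ≥ 0, ∀ x ∈ Icc 0 L, v t x = F (c * t + x) - F (c * t - x)) {t x : ℝ} (ht : 0 ≤ t)
    (hx : x ∈ Icc 0 L) (h1 : DifferentiableAt ℝ F (c * t + x))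
    (h2 : DifferentiableAt ℝ F (c * t - x)) :
    HasDerivWithinAt (fun s => v s x) (c * (deriv F (c * t + x) - deriv F (c * t - x)))
      (Ici 0) t := by
  have l1 : HasDerivAt (fun s => c * s + x) c t := by
    simpa using ((hasDerivAt_id t).const_mul c).add_const x
  have l2 : HasDerivAt (fun s => c * s - x) c t := by
    simpa using ((hasDerivAt_id t).const_mul c).sub_const x
  have d3 := ((h1.hasDerivAt.comp t l1).sub (h2.hasDerivAt.comp t l2)).hasDerivWithinAt
    (s := Ici 0)
  have e : deriv F (c * t + x) * c - deriv F (c * t - x) * c =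
      c * (deriv F (c * t + x) - deriv F (c * t - x)) := by ring
  rw [e] at d3
  exact d3.congr (fun s hs => hF s hs x hx) (hF t ht x hx)

theorem energyDensity_eq (hc : 0 < c)
    (hF : ∀ t ≥ 0, ∀ x ∈ Icc 0 L, v t x = F (c * t + x) - F (c * t - x)) {t x : ℝ} (ht : 0 ≤ t)
    (hx : x ∈ Ioo 0 L) (h1 : DifferentiableAt ℝ F (c * t + x))
    (h2 : DifferentiableAt ℝ F (c * t - x)) :
    energyDensity c v t x = 2 * (deriv F (c * t + x) ^ 2 + deriv F (c * t - x) ^ 2) := by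
  have hx' := Ioo_subset_Icc_self hx
  have d1 := ((hasDerivWithinAt_space hF ht hx' h1 h2).hasDerivAt
    (Icc_mem_nhds hx.1 hx.2)).deriv
  have d2 := (hasDerivWithinAt_time hF ht hx' h1 h2).derivWithin (uniqueDiffOn_Ici 0 t ht)
  rw [energyDensity, d1, d2]
  field_simp
  ring

theorem ae_differentiableAt_pair (hc : 0 < c) (hd : ∀ᵐ s, -L < s → DifferentiableAt ℝ F s)
    {t : ℝ} (ht : 0 ≤ t) :
    ∀ᵐ x, x ∈ Ioo 0 L → DifferentiableAt ℝ F (c * t + x) ∧ DifferentiableAt ℝ F (c * t - x) := by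
  have h0 : 0 ≤ c * t := mul_nonneg hc.le ht
  filter_upwards [ae_affine hd one_ne_zero (c * t), ae_affine hd (neg_ne_zero.2 one_ne_zero) (c * t)]
    with x h1 h2 hx
  rw [one_mul, add_comm] at h1
  rw [neg_one_mul, neg_add_eq_sub] at h2
  exact ⟨h1 (by linarith [hx.1, hx.2]), h2 (by linarith [hx.1, hx.2])⟩

theorem ae_energyDensity_eq (hc : 0 < c)
    (hF : ∀ t ≥ 0, ∀ x ∈ Icc 0 L, v t x = F (c * t + x) - F (c * t - x))
    (hd : ∀ᵐ s, -L < s → DifferentiableAt ℝ F s) {t : ℝ} (ht : 0 ≤ t) :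
    ∀ᵐ x ∂(volume.restrict (Ioo 0 L)),
      energyDensity c v t x = 2 * (deriv F (c * t + x) ^ 2 + deriv F (c * t - x) ^ 2) := by
  rw [ae_restrict_iff' measurableSet_Ioo]
  filter_upwards [ae_differentiableAt_pair hc hd ht] with x h hx
  exact energyDensity_eq hc hF ht hx (h hx).1 (h hx).2

/-- The densities on the two families of characteristics, `F' (c t + x)²` and `F' (c t - x)²`, glue
after reflecting `x` into one integral over a window of length `2 L`. -/
theorem energy_eq_of_intervalIntegrable (hL : 0 < L) (hc : 0 < c)
    (hF : ∀ t ≥ 0, ∀ x ∈ Icc 0 L, v t x = F (c * t + x) - F (c * t - x))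
    (hd : ∀ᵐ s, -L < s → DifferentiableAt ℝ F s) {t : ℝ} (ht : 0 ≤ t)
    (hi : IntervalIntegrable (fun s => deriv F s ^ 2) volume (c * t - L) (c * t + L)) :
    IntegrableOn (energyDensity c v t) (Ioo 0 L) ∧
      energy L c v t = ∫ s in (c * t - L)..(c * t + L), deriv F s ^ 2 := by
  have hi1 : IntervalIntegrable (fun s => deriv F s ^ 2) volume (c * t) (c * t + L) :=
    hi.mono_set (by
      rw [uIcc_of_le (by linarith), uIcc_of_le (by linarith)]
      exact Icc_subset_Icc (by linarith) le_rfl)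
  have hi2 : IntervalIntegrable (fun s => deriv F s ^ 2) volume (c * t - L) (c * t) :=
    hi.mono_set (by
      rw [uIcc_of_le (by linarith), uIcc_of_le (by linarith)]
      exact Icc_subset_Icc le_rfl (by linarith))
  have j1 : IntervalIntegrable (fun x => deriv F (c * t + x) ^ 2) volume 0 L := by
    have := hi1.comp_add_left (c * t)
    simpa using this
  have j2 : IntervalIntegrable (fun x => deriv F (c * t - x) ^ 2) volume 0 L := by
    have := hi2.comp_sub_left (c * t)
    simpa using this.symm
  have hae := ae_energyDensity_eq hc hF hd ht
  have j : IntervalIntegrable (fun x => 2 * (deriv F (c * t + x) ^ 2 + deriv F (c * t - x) ^ 2))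
      volume 0 L := (j1.add j2).const_mul 2
  constructor
  · have h1 : IntegrableOn (fun x => 2 * (deriv F (c * t + x) ^ 2 + deriv F (c * t - x) ^ 2))
        (Ioo 0 L) := ((intervalIntegrable_iff_integrableOn_Ioc_of_le hL.le).1 j).mono_set
          Ioo_subset_Ioc_self
    exact h1.congr (hae.mono fun x hx => hx.symm)
  · rw [energy, integral_congr_ae hae, ← integral_Ioc_eq_integral_Ioo,
      ← intervalIntegral.integral_of_le hL.le, intervalIntegral.integral_const_mul,
      intervalIntegral.integral_add j1 j2,
      intervalIntegral.integral_comp_add_left (fun s => deriv F s ^ 2),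
      intervalIntegral.integral_comp_sub_left (fun s => deriv F s ^ 2),
      ← intervalIntegral.integral_add_adjacent_intervals hi2 hi1]
    simp only [sub_zero, add_zero]
    ring

/-- At `t = 0` the data determine `F'` at `x` and `-x` as `(y₀' ± y₁ / c) / 2`, a combination of
square-integrable functions. -/
theorem InitialState.integrable_deriv_sq {y₀ y₁ : ℝ → ℝ} (hy : InitialState L y₀ y₁)
    (hL : 0 < L) (hc : 0 < c)
    (hF : ∀ t ≥ 0, ∀ x ∈ Icc 0 L, v t x = F (c * t + x) - F (c * t - x))
    (hd : ∀ᵐ s, -L < s → DifferentiableAt ℝ F s)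
    (hpos : ∀ x ∈ Icc 0 L, v 0 x = y₀ x)
    (hvel : ∀ᵐ x ∂(volume.restrict (Ioo 0 L)),
      HasDerivWithinAt (fun t => v t x) (y₁ x) (Ici 0) 0) :
    IntervalIntegrable (fun s => deriv F s ^ 2) volume (-L) L := by
  have key : ∀ᵐ x, x ∈ Ioo 0 L → deriv F x = (deriv y₀ x + y₁ x / c) / 2 ∧
      deriv F (-x) = (deriv y₀ x - y₁ x / c) / 2 := by
    rw [ae_restrict_iff' measurableSet_Ioo] at hvel
    filter_upwards [hvel, ae_differentiableAt_pair hc hd le_rfl] with x h1 h2 hx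
    have hx' := Ioo_subset_Icc_self hx
    have d1 := (hasDerivWithinAt_space hF le_rfl hx' (h2 hx).1 (h2 hx).2).hasDerivAt
      (Icc_mem_nhds hx.1 hx.2)
    have d2 := hasDerivWithinAt_time hF le_rfl hx' (h2 hx).1 (h2 hx).2
    have e2 := (uniqueDiffOn_Ici (0 : ℝ) 0 self_mem_Ici).eq_deriv _ (h1 hx) d2
    have e1 : deriv y₀ x = deriv F (c * 0 + x) + deriv F (c * 0 - x) := by
      rw [← d1.deriv]
      refine Filter.EventuallyEq.deriv_eq ?_
      filter_upwards [Icc_mem_nhds hx.1 hx.2] with y hy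
      exact (hpos y hy).symm
    rw [mul_zero, zero_add, zero_sub] at e1 e2
    rw [e1, e2]
    constructor <;> field_simp <;> ring
  have s1 : IntegrableOn (fun x => ((deriv y₀ x + y₁ x / c) / 2) ^ 2) (Ioo 0 L) := by
    have h := (hy.memLp_deriv.add (hy.memLp_velocity.const_mul c⁻¹)).const_mul (1 / 2)
    refine (h.integrable_sq).congr (Eventually.of_forall fun x => ?_)
    simp only [Pi.add_apply]
    ring
  have s2 : IntegrableOn (fun x => ((deriv y₀ x - y₁ x / c) / 2) ^ 2) (Ioo 0 L) := by
    have h := (hy.memLp_deriv.sub (hy.memLp_velocity.const_mul c⁻¹)).const_mul (1 / 2)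
    refine (h.integrable_sq).congr (Eventually.of_forall fun x => ?_)
    simp only [Pi.sub_apply]
    ring
  have t1 : IntervalIntegrable (fun s => deriv F s ^ 2) volume 0 L := by
    rw [intervalIntegrable_iff_integrableOn_Ioo_of_le hL.le]
    refine s1.congr ?_
    rw [EventuallyEq, ae_restrict_iff' measurableSet_Ioo]
    filter_upwards [key] with x hx hx'
    rw [(hx hx').1]
  have t2 : IntervalIntegrable (fun s => deriv F (-s) ^ 2) volume 0 L := by
    rw [intervalIntegrable_iff_integrableOn_Ioo_of_le hL.le]
    refine s2.congr ?_
    rw [EventuallyEq, ae_restrict_iff' measurableSet_Ioo]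
    filter_upwards [key] with x hx hx'
    rw [(hx hx').2]
  have t3 : IntervalIntegrable (fun s => deriv F s ^ 2) volume (-L) 0 := by
    have := t2.comp_sub_left 0
    simpa using this.symm
  exact t3.trans t1

theorem ae_recursion_free (hL : 0 < L) (hc : 0 < c)
    (hF : ∀ t ≥ 0, ∀ x ∈ Icc 0 L, v t x = F (c * t + x) - F (c * t - x))
    (hd : ∀ᵐ s, -L < s → DifferentiableAt ℝ F s) {T : ℝ}
    (hr : ∀ᵐ t ∂(volume.restrict (Ioo 0 T)), HasDerivWithinAt (fun x => v t x) 0 (Iic L) L) :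
    ∀ᵐ t, t ∈ Ioo 0 T → deriv F (c * t + L) = -deriv F (c * t - L) := by
  rw [ae_restrict_iff' measurableSet_Ioo] at hr
  filter_upwards [hr, ae_affine hd hc.ne' L, ae_affine hd hc.ne' (-L)] with t h1 h2 h3 ht
  have ht0 : 0 < c * t := mul_pos hc ht.1
  rw [← sub_eq_add_neg] at h3
  have d1 := hasDerivWithinAt_space hF ht.1.le (right_mem_Icc.2 hL.le) (h2 (by linarith))
    (h3 (by linarith))
  have d2 := (h1 ht).mono (Icc_subset_Iic_self (a := 0))
  have := (uniqueDiffOn_Icc hL L (right_mem_Icc.2 hL.le)).eq_deriv _ d1 d2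
  linarith

/-- At `x = L` the slope is `F' (c t + L) + F' (c t - L)` and the velocity is `c` times the
corresponding difference. A delay `d L / c` shifts the arguments of the latter by `d L`, giving the
pairs `3, 5` for `d = 4` and `7, 9` for `d = 8`. -/
theorem ae_recursion_feedback (hL : 0 < L) (hc : 0 < c)
    (hF : ∀ t ≥ 0, ∀ x ∈ Icc 0 L, v t x = F (c * t + x) - F (c * t - x))
    (hd : ∀ᵐ s, -L < s → DifferentiableAt ℝ F s) {f : ℝ} {δ : ℝ → ℝ}
    (hδ : ∀ t ≥ 0, δ t = 4 * (L / c) ∨ δ t = 8 * (L / c))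
    (hr : ∀ᵐ t ∂(volume.restrict (Ioi (8 * (L / c)))),
      ∃ w : ℝ, HasDerivAt (fun s => v s L) w (t - δ t) ∧
        HasDerivWithinAt (fun x => v t x) (f / c * w) (Iic L) L) :
    ∀ᵐ t, 8 * (L / c) < t →
      deriv F (c * t + L) = -deriv F (c * t - L) +
          f * (deriv F (c * t - 3 * L) - deriv F (c * t - 5 * L)) ∨
      deriv F (c * t + L) = -deriv F (c * t - L) +
          f * (deriv F (c * t - 7 * L) - deriv F (c * t - 9 * L)) := by
  rw [ae_restrict_iff' measurableSet_Ioi] at hr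
  filter_upwards [hr, ae_affine hd hc.ne' L, ae_affine hd hc.ne' (-L),
    ae_affine hd hc.ne' (-(3 * L)), ae_affine hd hc.ne' (-(5 * L)),
    ae_affine hd hc.ne' (-(7 * L)), ae_affine hd hc.ne' (-(9 * L))] with t h0 h1 h2 h3 h5 h7 h9 ht
  simp only [← sub_eq_add_neg] at h2 h3 h5 h7 h9
  have hLc : 0 < L / c := div_pos hL hc
  have ht0 : 0 < t := by linarith
  have hct : 8 * L < c * t := by
    have := mul_lt_mul_of_pos_left ht hc
    have e : c * (8 * (L / c)) = 8 * L := by field_simp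
    linarith
  obtain ⟨w, hw1, hw2⟩ := h0 ht
  have d1 := hasDerivWithinAt_space hF ht0.le (right_mem_Icc.2 hL.le) (h1 (by linarith))
    (h2 (by linarith))
  have hbd := (uniqueDiffOn_Icc hL L (right_mem_Icc.2 hL.le)).eq_deriv _ d1
    (hw2.mono (Icc_subset_Iic_self (a := 0)))
  have hw : ∀ d : ℝ, δ t = d * (L / c) → d ≤ 8 →
      DifferentiableAt ℝ F (c * t - (d - 1) * L) → DifferentiableAt ℝ F (c * t - (d + 1) * L) →
      w = c * (deriv F (c * t - (d - 1) * L) - deriv F (c * t - (d + 1) * L)) := by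
    intro d hdt hd8 k1 k2
    have hpos : 0 < t - δ t := by
      rw [hdt]
      have := mul_le_mul_of_nonneg_right hd8 hLc.le
      linarith
    have e1 : c * (t - δ t) + L = c * t - (d - 1) * L := by rw [hdt]; field_simp; ring
    have e2 : c * (t - δ t) - L = c * t - (d + 1) * L := by rw [hdt]; field_simp; ring
    have d2 := hasDerivWithinAt_time hF hpos.le (right_mem_Icc.2 hL.le) (by rwa [e1]) (by rwa [e2])
    rw [e1, e2] at d2
    exact (uniqueDiffOn_Ici (0 : ℝ) _ hpos.le).eq_deriv _ hw1.hasDerivWithinAt d2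
  have hfin : ∀ X : ℝ, w = c * X →
      deriv F (c * t + L) = -deriv F (c * t - L) + f * X := by
    intro X hX
    rw [hX] at hbd
    have : f / c * (c * X) = f * X := by field_simp
    linarith
  rcases hδ t ht0.le with h | h
  · left
    have := hw 4 h (by norm_num) (by norm_num; exact h3 (by linarith))
      (by norm_num; exact h5 (by linarith))
    norm_num at this
    exact hfin _ this
  · right
    have := hw 8 h le_rfl (by norm_num; exact h7 (by linarith))
      (by norm_num; exact h9 (by linarith))
    norm_num at this
    exact hfin _ this

end

/-! ### Decay of the profile's derivative and of the energy -/

section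

variable {L c : ℝ} {v : ℝ → ℝ → ℝ} {F : ℝ → ℝ}

/-- Only countably many times `(r + (2 n + 1) L) / c` matter for a given `r`, so for almost every
`r` the boundary relations hold at all of them and the scalar recursion applies. -/
theorem ae_abs_le {g : ℝ → ℝ} (hc : 0 < c) {f : ℝ} (hf0 : f < 0) (hf1 : -(1 / 22) ≤ f)
    (hfree : ∀ᵐ t, t ∈ Ioo 0 (8 * (L / c)) → g (c * t + L) = -g (c * t - L))
    (hfeed : ∀ᵐ t, 8 * (L / c) < t →
      g (c * t + L) = -g (c * t - L) + f * (g (c * t - 3 * L) - g (c * t - 5 * L)) ∨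
      g (c * t + L) = -g (c * t - L) + f * (g (c * t - 7 * L) - g (c * t - 9 * L))) :
    ∀ᵐ r, r ∈ Ioo (-L) L →
      ∀ n : ℕ, |g (r + 2 * n * L)| ≤ |g r| / (1 + f) ^ 4 * (1 + f) ^ n := by
  have h1 : ∀ᵐ r, ∀ n : ℕ, c⁻¹ * r + c⁻¹ * ((2 * n + 1) * L) ∈ Ioo 0 (8 * (L / c)) →
      g (c * (c⁻¹ * r + c⁻¹ * ((2 * n + 1) * L)) + L) =
        -g (c * (c⁻¹ * r + c⁻¹ * ((2 * n + 1) * L)) - L) :=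
    ae_all_iff.2 fun n => ae_affine hfree (inv_ne_zero hc.ne') _
  -- The shift by `4` starts at time `(r + 9 L) / c`, the first of these times past `8 L / c`, since
  -- `r > -L`.
  have h2 := ae_all_iff.2 fun n : ℕ => ae_affine hfeed (inv_ne_zero hc.ne')
    (c⁻¹ * ((2 * (n + 4) + 1) * L))
  filter_upwards [h1, h2] with r k1 k2 hr n
  have ec : ∀ y : ℝ, c * (c⁻¹ * r + c⁻¹ * y) = r + y := fun y => by field_simp
  have hT : 8 * (L / c) = c⁻¹ * (8 * L) := by field_simp
  have hci : 0 < c⁻¹ := inv_pos.2 hc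
  -- The alternating sign absorbs the reflection `g ↦ -g` at the free end and turns the differences
  -- in the feedback into sums.
  have key := abs_le_of_delayed_recursion (h := -f) (a := fun n : ℕ => (-1) ^ n * g (r + 2 * n * L))
    (by linarith) (by linarith) ?_ ?_ n
  · simpa [abs_mul] using key
  · intro n hn
    have hn' : (n : ℝ) ≤ 3 := by exact_mod_cast Nat.le_of_lt_succ hn
    have hL : 0 < L := by linarith [hr.1, hr.2]
    have hnL := mul_le_mul_of_nonneg_right hn' hL.le
    have hnL0 : 0 ≤ (n : ℝ) * L := by positivity
    have := k1 n ⟨by rw [← mul_add]; exact mul_pos hci (by linarith [hr.1]), by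
      rw [← mul_add, hT]; exact mul_lt_mul_of_pos_left (by linarith [hr.2]) hci⟩
    rw [ec] at this
    rw [show r + (2 * (n : ℝ) + 1) * L + L = r + 2 * (n + 1 : ℕ) * L by push_cast; ring,
      show r + (2 * (n : ℝ) + 1) * L - L = r + 2 * n * L by ring] at this
    simp only [this]
    ring
  · intro n
    have hL : 0 < L := by linarith [hr.1, hr.2]
    have hnL0 : 0 ≤ (n : ℝ) * L := by positivity
    have := k2 n (by
      rw [← mul_add, hT]; exact mul_lt_mul_of_pos_left (by linarith [hr.1]) hci)
    rw [ec] at this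
    rw [show r + (2 * ((n : ℝ) + 4) + 1) * L + L = r + 2 * (n + 5 : ℕ) * L by push_cast; ring,
      show r + (2 * ((n : ℝ) + 4) + 1) * L - L = r + 2 * (n + 4 : ℕ) * L by push_cast; ring,
      show r + (2 * ((n : ℝ) + 4) + 1) * L - 3 * L = r + 2 * (n + 3 : ℕ) * L by push_cast; ring,
      show r + (2 * ((n : ℝ) + 4) + 1) * L - 5 * L = r + 2 * (n + 2 : ℕ) * L by push_cast; ring,
      show r + (2 * ((n : ℝ) + 4) + 1) * L - 7 * L = r + 2 * (n + 1 : ℕ) * L by push_cast; ring,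
      show r + (2 * ((n : ℝ) + 4) + 1) * L - 9 * L = r + 2 * n * L by ring] at this
    rcases this with this | this
    · left
      simp only [this]
      ring
    · right
      simp only [this]
      ring

/-- Pointwise geometric decay along translates gives decay of the square integrals over windows. -/
theorem window_integral_le {g : ℝ → ℝ} (hg : Measurable g) (hL : 0 < L) {κ : ℝ} (hκ : 0 < κ)
    (hi : IntervalIntegrable (fun s => g s ^ 2) volume (-L) L)
    (hdec : ∀ᵐ r, r ∈ Ioo (-L) L → ∀ n : ℕ, |g (r + 2 * n * L)| ≤ |g r| / κ ^ 4 * κ ^ n) (n : ℕ) :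
    IntervalIntegrable (fun s => g s ^ 2) volume (2 * n * L - L) (2 * n * L + L) ∧
      ∫ s in (2 * n * L - L)..(2 * n * L + L), g s ^ 2 ≤
        (κ ^ 8)⁻¹ * (κ ^ 2) ^ n * ∫ s in (-L)..L, g s ^ 2 := by
  have hpt : ∀ᵐ r, r ∈ Ioo (-L) L →
      g (r + 2 * n * L) ^ 2 ≤ (κ ^ 8)⁻¹ * (κ ^ 2) ^ n * g r ^ 2 := by
    filter_upwards [hdec] with r h hr
    have h1 := pow_le_pow_left₀ (abs_nonneg _) (h hr n) 2
    rw [sq_abs] at h1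
    refine h1.trans (le_of_eq ?_)
    rw [mul_pow, div_pow, sq_abs]
    field_simp
    ring
  have hle : -L ≤ L := by linarith
  have hm : Measurable fun r => g (r + 2 * n * L) ^ 2 := by fun_prop
  have i1 : IntervalIntegrable (fun r => g (r + 2 * n * L) ^ 2) volume (-L) L := by
    rw [intervalIntegrable_iff_integrableOn_Ioo_of_le hle] at hi ⊢
    refine (hi.const_mul ((κ ^ 8)⁻¹ * (κ ^ 2) ^ n)).mono' hm.aestronglyMeasurable ?_
    rw [ae_restrict_iff' measurableSet_Ioo]
    filter_upwards [hpt] with r h hr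
    rw [Real.norm_of_nonneg (sq_nonneg _)]
    exact h hr
  have e1 : -L + 2 * n * L = 2 * n * L - L := by ring
  have e2 : L + 2 * n * L = 2 * n * L + L := by ring
  constructor
  · have := i1.comp_sub_right (2 * n * L)
    simpa [e1, e2] using this
  · rw [← e1, ← e2, ← intervalIntegral.integral_comp_add_right (fun s => g s ^ 2),
      ← intervalIntegral.integral_const_mul]
    rw [intervalIntegral.integral_of_le hle, intervalIntegral.integral_of_le hle,
      integral_Ioc_eq_integral_Ioo, integral_Ioc_eq_integral_Ioo]
    rw [intervalIntegrable_iff_integrableOn_Ioo_of_le hle] at hi i1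
    refine setIntegral_mono_ae_restrict i1 (hi.const_mul _) ?_
    rw [EventuallyLE, ae_restrict_iff' measurableSet_Ioo]
    exact hpt

theorem energy_nonneg (t : ℝ) : 0 ≤ energy L c v t :=
  mul_nonneg (by norm_num) (integral_nonneg fun x => by
    simp only [energyDensity, Pi.zero_apply]
    positivity)

/-- For small negative feedback the energy at times after the `j`-th period has decayed by the
factor `(1 + f) ^ (2 j)`, uniformly over all switching delays. -/
theorem IsSolution.energy_le {f : ℝ} {δ y₀ y₁ : ℝ → ℝ} (hv : IsSolution L c f 2 δ y₀ y₁ v)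
    (hL : 0 < L) (hc : 0 < c) (hf0 : f < 0) (hf1 : -(1 / 22) ≤ f)
    (hδ : ∀ t ≥ 0, δ t = 4 * (L / c) ∨ δ t = 8 * (L / c)) (hy : InitialState L y₀ y₁) :
    (∀ t ≥ 0, IntegrableOn (energyDensity c v t) (Ioo 0 L)) ∧
      ∀ (j : ℕ) (t : ℝ), 2 * j * (L / c) ≤ t →
        energy L c v t ≤ 2 * ((1 + f) ^ 8)⁻¹ * ((1 + f) ^ 2) ^ j * energy L c v 0 := by
  have hleft : ∀ t ≥ 0, v t 0 = 0 := by
    intro t ht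
    rcases eq_or_lt_of_le ht with rfl | ht
    · rw [hv.initial_position 0 ⟨le_rfl, hL.le⟩, hy.zero]
    · exact hv.left_end t ht
  obtain ⟨F, hF, hd⟩ := hv.wave.exists_profile hL hc hv.continuousOn hleft
  have hi := hy.integrable_deriv_sq hL hc hF hd hv.initial_position hv.initial_velocity
  have hT : 4 * ((2 : ℕ) : ℝ) * (L / c) = 8 * (L / c) := by push_cast; ring
  have hfree := hv.right_end_free
  have hfeed := hv.right_end_feedback
  rw [hT] at hfree hfeed
  have hdec := ae_abs_le hc hf0 hf1 (ae_recursion_free hL hc hF hd hfree)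
    (ae_recursion_feedback hL hc hF hd hδ hfeed)
  set κ := 1 + f with hκ
  have hκ0 : 0 < κ := by linarith
  have hκ1 : κ ≤ 1 := by linarith
  have hwin := window_integral_le (measurable_deriv F) hL hκ0 hi hdec
  have hE0 : energy L c v 0 = ∫ s in (-L)..L, deriv F s ^ 2 := by
    have := (energy_eq_of_intervalIntegrable hL hc hF hd le_rfl (by simpa using hi)).2
    simpa using this
  have hloc : ∀ t ≥ 0, ∀ j : ℕ, 2 * j * (L / c) ≤ t → ∃ n : ℕ, j ≤ n ∧
      2 * n * L ≤ c * t ∧ c * t ≤ 2 * (n + 1 : ℕ) * L := by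
    intro t ht j hj
    have hjt : 2 * j * L ≤ c * t := by
      have := mul_le_mul_of_nonneg_left hj hc.le
      have e : c * (2 * j * (L / c)) = 2 * j * L := by field_simp
      linarith
    refine ⟨⌊c * t / (2 * L)⌋₊, Nat.le_floor ?_, ?_, ?_⟩
    · rw [le_div_iff₀ (by linarith)]
      linarith
    · have := Nat.floor_le (a := c * t / (2 * L)) (by positivity)
      rw [le_div_iff₀ (by linarith)] at this
      linarith
    · have := (Nat.lt_floor_add_one (c * t / (2 * L))).le
      rw [div_le_iff₀ (by linarith)] at this
      push_cast
      linarith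
  -- The window `[c t - L, c t + L]` is covered by two consecutive windows centred at even multiples
  -- of `L`; this is the factor `2`.
  have hii : ∀ n : ℕ, IntervalIntegrable (fun s => deriv F s ^ 2) volume
      (2 * n * L - L) (2 * (n + 1 : ℕ) * L + L) ∧
      ∫ s in (2 * n * L - L)..(2 * (n + 1 : ℕ) * L + L), deriv F s ^ 2 ≤
        2 * (κ ^ 8)⁻¹ * (κ ^ 2) ^ n * energy L c v 0 := by
    intro n
    obtain ⟨a1, a2⟩ := hwin n
    obtain ⟨b1, b2⟩ := hwin (n + 1)
    have e : 2 * ((n + 1 : ℕ) : ℝ) * L - L = 2 * n * L + L := by push_cast; ring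
    rw [e] at b1 b2
    refine ⟨a1.trans b1, ?_⟩
    rw [← intervalIntegral.integral_add_adjacent_intervals a1 b1]
    rw [← hE0] at a2 b2
    have h1 : (κ ^ 2) ^ (n + 1) ≤ (κ ^ 2) ^ n :=
      pow_le_pow_of_le_one (by positivity) (pow_le_one₀ hκ0.le hκ1) (Nat.le_succ n)
    have h2 : (κ ^ 8)⁻¹ * (κ ^ 2) ^ (n + 1) * energy L c v 0 ≤
        (κ ^ 8)⁻¹ * (κ ^ 2) ^ n * energy L c v 0 :=
      mul_le_mul_of_nonneg_right (mul_le_mul_of_nonneg_left h1 (by positivity)) (energy_nonneg 0)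
    linarith
  have hit : ∀ t ≥ 0, ∀ n : ℕ, 2 * n * L ≤ c * t → c * t ≤ 2 * (n + 1 : ℕ) * L →
      IntervalIntegrable (fun s => deriv F s ^ 2) volume (c * t - L) (c * t + L) := by
    intro t ht n h1 h2
    refine (hii n).1.mono_set ?_
    rw [uIcc_of_le (by linarith), uIcc_of_le (by linarith)]
    exact Icc_subset_Icc (by linarith) (by linarith)
  refine ⟨fun t ht => ?_, fun j t hj => ?_⟩
  · obtain ⟨n, -, h1, h2⟩ := hloc t ht 0 (by simpa using ht)
    exact (energy_eq_of_intervalIntegrable hL hc hF hd ht (hit t ht n h1 h2)).1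
  · have ht : 0 ≤ t := le_trans (by positivity) hj
    obtain ⟨n, hjn, h1, h2⟩ := hloc t ht j hj
    rw [(energy_eq_of_intervalIntegrable hL hc hF hd ht (hit t ht n h1 h2)).2]
    have hmono : ∫ s in (c * t - L)..(c * t + L), deriv F s ^ 2 ≤
        ∫ s in (2 * n * L - L)..(2 * (n + 1 : ℕ) * L + L), deriv F s ^ 2 :=
      intervalIntegral.integral_mono_interval (by linarith) (by linarith) (by linarith)
        (Eventually.of_forall fun s => sq_nonneg _) (hii n).1
    refine hmono.trans ((hii n).2.trans ?_)
    refine mul_le_mul_of_nonneg_right (mul_le_mul_of_nonneg_left ?_ (by positivity))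
      (energy_nonneg 0)
    exact pow_le_pow_of_le_one (by positivity) (pow_le_one₀ hκ0.le hκ1) hjn

end

/-! ### Location of `f₀` and the choice of constants -/

theorem f₀_mem : f₀ ∈ Ioo (-(1 / 22) : ℝ) 0 := by
  have h1 : Real.sqrt 467857 ≤ 685 := by
    rw [Real.sqrt_le_left (by norm_num)]
    norm_num
  have h2 := Real.sqrt_nonneg 467857
  constructor
  · rw [f₀, lt_div_iff₀ (by norm_num)]
    linarith
  · rw [f₀, div_lt_iff₀ (by norm_num)]
    linarith

end DelayedWave

theorem theorem1 (L c : ℝ) (hL : 0 < L) (hc : 0 < c) :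
    ∃ U ∈ 𝓝 DelayedWave.f₀, ∀ f ∈ U,
      ∃ C₀ > 0, ∃ q : ℝ, 0 < q ∧ q < 1 ∧ ∃ C₁ > 0, ∃ μ > 0,
        ∀ δ : ℝ → ℝ, DelayedWave.PiecewiseConstant δ →
          (∀ t ≥ 0, δ t = 4 * (L / c) ∨ δ t = 8 * (L / c)) →
        ∀ y₀ y₁ : ℝ → ℝ, DelayedWave.InitialState L y₀ y₁ →
        ∀ v : ℝ → ℝ → ℝ, DelayedWave.IsSolution L c f 2 δ y₀ y₁ v →
          (∀ t ≥ 0, IntegrableOn (DelayedWave.energyDensity c v t) (Ioo 0 L)) ∧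
          (∀ t ≥ 0, DelayedWave.energy L c v t ≤
            C₁ * DelayedWave.energy L c v 0 * Real.exp (-μ * t)) ∧
          (∀ j : ℕ, ∀ t ∈ Ico 0 (2 * (L / c)),
            DelayedWave.energy₁ L c v (t + 2 * j * (L / c)) ≤
              q ^ j * C₀ * DelayedWave.energy₁ L c v 0) := by
  refine ⟨Ioo (-(1 / 22)) 0, Ioo_mem_nhds DelayedWave.f₀_mem.1 DelayedWave.f₀_mem.2,
    fun f hf => ?_⟩
  have hκ0 : 0 < 1 + f := by linarith [hf.1]
  have hκ1 : 1 + f < 1 := by linarith [hf.2]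
  set q := (1 + f) ^ 2 with hq
  set A := 2 * ((1 + f) ^ 8)⁻¹ with hA
  have hA0 : 0 < A := by positivity
  have hq0 : 0 < q := by positivity
  have hq1 : q < 1 := pow_lt_one₀ hκ0.le hκ1 two_ne_zero
  have hLc : 0 < L / c := div_pos hL hc
  -- Chosen so that `exp (-μ * (2 L / c)) = q`, one factor `q` per period.
  set μ := -Real.log q / (2 * (L / c)) with hμ
  have hμ0 : 0 < μ := div_pos (neg_pos.2 (Real.log_neg hq0 hq1)) (by positivity)
  -- `5` counts the terms of `E₁`, each at most `A q ^ j E(0)` with `E(0) ≤ E₁(0)`. The division by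
  -- `q` pays for rounding `t` down to a whole number of periods.
  refine ⟨5 * A, by positivity, q, hq0, hq1, A / q, by positivity, μ, hμ0,
    fun δ _ hδ y₀ y₁ hy v hv => ?_⟩
  obtain ⟨hint, hE⟩ := hv.energy_le hL hc hf.2 hf.1.le hδ hy
  have hnn := fun t => DelayedWave.energy_nonneg (L := L) (c := c) (v := v) t
  refine ⟨hint, fun t ht => ?_, fun j t ht => ?_⟩
  · set n := ⌊t / (2 * (L / c))⌋₊ with hn
    have h1 := Nat.floor_le (a := t / (2 * (L / c))) (by positivity)
    have h2 := Nat.lt_floor_add_one (t / (2 * (L / c)))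
    rw [← hn] at h1 h2
    have h3 : q ^ (n + 1) ≤ Real.exp (-μ * t) := by
      rw [← Real.exp_log (pow_pos hq0 (n + 1)), Real.log_pow]
      refine Real.exp_le_exp.2 ?_
      have h4 : -μ * t = Real.log q * (t / (2 * (L / c))) := by rw [hμ]; ring
      rw [h4, mul_comm]
      push_cast
      exact mul_le_mul_of_nonpos_left h2.le (Real.log_neg hq0 hq1).le
    have h5 := hE n t (by
      rw [le_div_iff₀ (by positivity)] at h1
      linarith)
    refine h5.trans ?_
    have h6 : A * q ^ n * DelayedWave.energy L c v 0 =
        A / q * DelayedWave.energy L c v 0 * q ^ (n + 1) := by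
      field_simp
      ring
    rw [h6]
    exact mul_le_mul_of_nonneg_left h3 (mul_nonneg (by positivity) (hnn 0))
  · have hsum : DelayedWave.energy₁ L c v (t + 2 * j * (L / c)) ≤
        ∑ i ∈ Finset.range 5, A * q ^ j * DelayedWave.energy L c v 0 := by
      refine Finset.sum_le_sum fun i _ => hE j _ ?_
      have : 0 ≤ 2 * (i : ℝ) * (L / c) := by positivity
      linarith [ht.1]
    have h0 : DelayedWave.energy L c v 0 ≤ DelayedWave.energy₁ L c v 0 := by
      have := Finset.single_le_sum (f := fun j : ℕ => DelayedWave.energy L c v (0 + 2 * j * (L / c)))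
        (fun i _ => hnn _) (Finset.mem_range.2 (by norm_num : 0 < 5))
      simpa [DelayedWave.energy₁] using this
    refine hsum.trans ?_
    rw [Finset.sum_const, Finset.card_range, nsmul_eq_mul]
    push_cast
    calc 5 * (A * q ^ j * DelayedWave.energy L c v 0)
        = q ^ j * (5 * A) * DelayedWave.energy L c v 0 := by ring
      _ ≤ _ := mul_le_mul_of_nonneg_left h0 (by positivity)
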